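/- For a polynomial $f(x)=c\prod_{k=1}^{d}(x-x_k)$ with $c\neq0$, the discriminant is $\Delta_f=c^{2d-2}\prod_{1\le j<k\le d}(x_j-x_k)^2$. For an integer $d\ge2$ and numbers $a,\lambda$ put $$G_{a,\lambda}(x)=x^d+\sum_{k=1}^{\lfloor d/2\rfloor}\left((-1)^k a^{2k}\binom{d}{2k}\frac{(2k-1)!!}{\prod_{j=1}^{k}(\lambda-2d+2j+1)}\right)x^{d-2k}.$$ Suppose that $a>0$, $d\ge2$ and $a^d<m\le 2^{d-1}a^d$. Then there is a unique real number $\lambda_0=\lambda_0(a,d,m)\ge 2d-2$ satisfying $$1+\sum_{k=1}^{\lfloor d/2\rfloor}\binom{d}{2k}\frac{(2k-1)!!}{\prod_{j=1}^{k}(\lambda_0-2d+2j+1)}=\frac{m}{a^d}.$$ With $G=G_{a,\lambda_0}$, every monic polynomial $f$ of degree $d$ with $d$ real roots (counted with multiplicity) and $|f(ai)|=m$ satisfies $\Delta_f\le\Delta_G$. Moreover, $G$ is itself such a polynomial, and equality $\Delta_f=\Delta_G$ holds if and only if $f=G$. Finally, for any $d\ge 2$ and any $\lambda,a\in\mathbb{C}$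 with $\lambda\notin\{2\lceil d/2\rceil-1,\,2\lceil d/2\rceil+1,\dots,2d-3\}$, $$\Delta_{G_{a,\lambda}}=a^{d(d-1)}\,\frac{\prod_{k=1}^{d}k^k\ \prod_{k=1}^{\lfloor d/2\rfloor-1}(\lambda-2k)^{2k}}{\prod_{k=\lceil d/2\rceil}^{d-1}(\lambda-2k+1)^{2k-1}}.$$ -/

import Mathlib

open Polynomial

/-- The product `∏_{j < k} (x_j - x_k)^2` over a finite family of elements of a field. -/
noncomputable def pairProd {K : Type*} [Field K] {n : ℕ} (x : Fin n → K) : K :=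
  ∏ j : Fin n, ∏ k ∈ Finset.Ioi j, (x j - x k) ^ 2

theorem pairProd_eq_det {K : Type*} [Field K] {n : ℕ} (x : Fin n → K) :
    pairProd x = (Matrix.vandermonde x).det ^ 2 := by
  rw [Matrix.det_vandermonde, pairProd, ← Finset.prod_pow]
  refine Finset.prod_congr rfl fun j _ => ?_
  rw [← Finset.prod_pow]
  exact Finset.prod_congr rfl fun k _ => by ring

theorem pairProd_comp_perm {K : Type*} [Field K] {n : ℕ} (x : Fin n → K)
    (σ : Equiv.Perm (Fin n)) : pairProd (x ∘ σ) = pairProd x := by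
  rw [pairProd_eq_det, pairProd_eq_det]
  have h : Matrix.vandermonde (x ∘ σ) = (Matrix.vandermonde x).submatrix σ id := by
    ext i j
    simp [Matrix.vandermonde]
  rw [h, Matrix.det_permute, mul_pow]
  rcases Int.units_eq_one_or (Equiv.Perm.sign σ) with h | h <;> simp [h]

theorem pairProd_cast {K : Type*} [Field K] {n m : ℕ} (e : n = m) (x : Fin m → K) :
    pairProd (x ∘ Fin.cast e) = pairProd x := by
  subst e
  rfl

theorem pairProd_ofFn {K : Type*} [Field K] {n : ℕ} (x : Fin n → K) :
    pairProd (List.ofFn x).get = pairProd x := by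
  rw [← pairProd_cast (List.length_ofFn (f := x)) x]
  congr 1
  ext i
  simp [Fin.cast]

theorem pairProd_perm {K : Type*} [Field K] {l l' : List K} (h : l.Perm l') :
    pairProd l.get = pairProd l'.get := by
  classical
  let σ : Equiv.Perm (Fin l.length) :=
    (Equiv.ofBijective h.idxBij
      ⟨h.idxBij_injective, fun i => ⟨h.symm.idxBij i, h.idxBij_idxBij_symm⟩⟩).trans
      (finCongr h.length_eq.symm)
  rw [← pairProd_cast h.length_eq l'.get, ← pairProd_comp_perm (l'.get ∘ Fin.cast h.length_eq) σ]
  congr 1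
  ext i
  exact (h.getElem_idxBij_eq_getElem i).symm

/-- The discriminant `c^(2d-2) ∏_{j < k} (x_j - x_k)^2` of a polynomial
`c ∏_{k ≤ d} (x - x_k)` that splits over the field `K`; the roots are listed with multiplicity.
The order of the list is irrelevant, see `rootDisc_eq`. -/
noncomputable def rootDisc {K : Type*} [Field K] (f : K[X]) : K :=
  f.leadingCoeff ^ (2 * f.natDegree - 2) * pairProd f.roots.toList.get

/-- `rootDisc` computed from an arbitrary enumeration of the roots. -/
theorem rootDisc_eq {K : Type*} [Field K] {d : ℕ} (c : K) (hc : c ≠ 0) (x : Fin d → K) :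
    rootDisc (C c * ∏ k, (X - C (x k))) =
      c ^ (2 * d - 2) * ∏ j : Fin d, ∏ k ∈ Finset.Ioi j, (x j - x k) ^ 2 := by
  have hm : (∏ k, (X - C (x k))).Monic := monic_prod_of_monic _ _ fun k _ => monic_X_sub_C _
  have hlc : (C c * ∏ k, (X - C (x k))).leadingCoeff = c := by
    rw [leadingCoeff_mul, hm.leadingCoeff, leadingCoeff_C, mul_one]
  have hdeg : (C c * ∏ k, (X - C (x k))).natDegree = d := by
    rw [natDegree_C_mul hc, natDegree_prod_of_monic _ _ fun k _ => monic_X_sub_C _]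
    simp
  have hroots : (C c * ∏ k, (X - C (x k))).roots = (List.ofFn x : Multiset K) := by
    rw [roots_C_mul _ hc, roots_prod _ _ hm.ne_zero]
    simp [List.ofFn_eq_map]
  have hperm : (List.ofFn x).Perm (C c * ∏ k, (X - C (x k))).roots.toList := by
    rw [← Multiset.coe_eq_coe, Multiset.coe_toList, hroots]
  rw [rootDisc, hlc, hdeg, ← pairProd_perm hperm, pairProd_ofFn, pairProd]

/-- The number `binom(d, 2k) (2k-1)!! / ∏_{j=1}^k (lam - 2d + 2j + 1)`. -/
noncomputable def gCoeff {K : Type*} [Field K] (d : ℕ) (lam : K) (k : ℕ) : K :=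
  (d.choose (2 * k) : K) * ((Nat.doubleFactorial (2 * k - 1) : ℕ) : K) /
    ∏ j ∈ Finset.Icc 1 k, (lam - 2 * (d : K) + 2 * (j : K) + 1)

/-- The polynomial `G_{a,lam}` of degree `d`:
`x^d + ∑_{k=1}^{⌊d/2⌋} (-1)^k a^(2k) binom(d,2k) (2k-1)!! / ∏_{j=1}^k (lam-2d+2j+1) x^(d-2k)`. -/
noncomputable def gPoly {K : Type*} [Field K] (d : ℕ) (a lam : K) : K[X] :=
  X ^ d + ∑ k ∈ Finset.Icc 1 (d / 2),
    C ((-1) ^ k * a ^ (2 * k) * gCoeff d lam k) * X ^ (d - 2 * k)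

/-- The monic real polynomials `f` of degree `d` with `d` real roots (counted with
multiplicity) and `|f(ai)| = m`. -/
def realRootedClass (d : ℕ) (a m : ℝ) : Set ℝ[X] :=
  {f | f.Monic ∧ f.natDegree = d ∧ f.Splits ∧ ‖aeval ((a : ℂ) * Complex.I) f‖ = m}

/-! Extremality. Instead of maximising the discriminant under the constraint |f(ai)| = m, maximise
`weightedDisc`, the discriminant times |f(ai)|^(-λ), over all real root vectors; λ plays the role of
a Lagrange multiplier. For λ > 2d-2 the weight dominates at infinity, so a maximiser exists and its
roots are distinct. Stationarity in each root says that (x²+a²)f'' - λxf' vanishes at every root of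
f. Adding d(λ-d+1)f removes the coefficient of x^d and leaves a polynomial of degree < d with d
zeros, so f solves a linear differential equation whose only monic solution of degree d is G
(`odeOp_eq_zero_of_max`, `eq_gPoly_of_odeOp_eq_zero`). Hence G is real-rooted and maximal. On the
class |f(ai)| = m the weight is constant, so the discriminant itself is compared, and equality makes
f another maximiser, hence equal to G. The multiplier λ₀ exists and is unique because |G(ai)|/a^d =
`gSum` decreases strictly from 2^(d-1) at λ = 2d-2 towards 1.

At λ = 2d-2 coercivity is lost and the equation has a line of monic solutions. There G = ((x+ai)^d +
(x-ai)^d)/2 is real-rooted by inspection, maximality is a limit from λ > 2d-2, and reality together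
with |f(ai)| = m selects G on the line.

Discriminant formula. With ν = λ-2d fixed, the polynomials G form an Appell sequence Q_n, and the
differential equation becomes a three-term recurrence. As in Schur's method, Res(Q_{n+2}, Q_{n+1})
then reduces to Res(Q_{n+1}, Q_n) and the values of Q_{n+1} at ±ai. This settles generic λ;
continuity gives the rest. -/

/-! ### Polynomials with prescribed roots; discriminant as a resultant. -/

section RootPolynomial

variable {K : Type*} [Field K] {d : ℕ}

/-- The monic polynomial `∏ (X - x_k)` with prescribed roots. -/
noncomputable def rootPoly (x : Fin d → K) : K[X] := ∏ k, (X - C (x k))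

theorem rootPoly_monic (x : Fin d → K) : (rootPoly x).Monic :=
  monic_prod_of_monic _ _ fun _ _ => monic_X_sub_C _

theorem rootPoly_natDegree (x : Fin d → K) : (rootPoly x).natDegree = d := by
  rw [rootPoly, natDegree_prod_of_monic _ _ fun _ _ => monic_X_sub_C _]
  simp

theorem rootPoly_splits (x : Fin d → K) : (rootPoly x).Splits :=
  Splits.prod fun _ _ => Splits.X_sub_C _

theorem exists_eq_rootPoly {f : K[X]} (hm : f.Monic) (hd : f.natDegree = d) (hs : f.Splits) :
    ∃ x : Fin d → K, f = rootPoly x := by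
  have hlen : f.roots.toList.length = d := by
    rw [Multiset.length_toList, ← hs.natDegree_eq_card_roots, hd]
  subst hlen
  refine ⟨f.roots.toList.get, ?_⟩
  conv_lhs => rw [hs.eq_prod_roots_of_monic hm, ← Multiset.coe_toList f.roots]
  rw [Multiset.map_coe, Multiset.prod_coe, rootPoly, ← List.prod_ofFn]
  congr 1
  conv_lhs => rw [← List.ofFn_get f.roots.toList, List.map_ofFn]
  rfl

theorem rootDisc_rootPoly (x : Fin d → K) : rootDisc (rootPoly x) = pairProd x := by
  have h := rootDisc_eq 1 one_ne_zero x
  rw [C_1, one_mul, one_pow, one_mul] at h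
  exact h

theorem rootPoly_eq_mul_erase (x : Fin d → K) (i : Fin d) :
    rootPoly x = (X - C (x i)) * ∏ k ∈ {i}ᶜ, (X - C (x k)) := by
  rw [rootPoly, Fintype.prod_eq_mul_prod_compl i]

theorem eval_derivative_rootPoly (x : Fin d → K) (i : Fin d) :
    (derivative (rootPoly x)).eval (x i) = ∏ k ∈ {i}ᶜ, (x i - x k) := by
  rw [rootPoly_eq_mul_erase x i, derivative_mul]
  simp [eval_prod]

/-- Each unordered pair occurs twice with opposite signs, which costs one factor -1 for each of the
d(d-1)/2 pairs. -/
theorem prod_prod_compl_sub (x : Fin d → K) :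
    ∏ i, ∏ k ∈ {i}ᶜ, (x i - x k) = (-1) ^ (d * (d - 1) / 2) * pairProd x := by
  have h := Finset.prod_prod_Ioi_mul_eq_prod_prod_off_diag (fun j i => x i - x j)
  rw [← h, pairProd]
  have h2 : ∀ i : Fin d, ∏ j ∈ Finset.Ioi i, (x i - x j) * (x j - x i) =
      (-1) ^ (Finset.Ioi i).card * ∏ j ∈ Finset.Ioi i, (x i - x j) ^ 2 := by
    intro i
    rw [← Finset.prod_const, ← Finset.prod_mul_distrib]
    exact Finset.prod_congr rfl fun j _ => by ring
  rw [Finset.prod_congr rfl fun i _ => h2 i, Finset.prod_mul_distrib, Finset.prod_pow_eq_pow_sum]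
  congr 2
  simp only [Fin.card_Ioi]
  rw [← Finset.sum_range_id_mul_two, Nat.mul_div_cancel _ two_pos,
    Finset.sum_range (fun i => i), ← Equiv.sum_comp Fin.revPerm]
  refine Finset.sum_congr rfl fun i _ => ?_
  simp only [Fin.revPerm_apply, Fin.val_rev]
  omega

theorem resultant_rootPoly (x : Fin d → K) (g : K[X]) (n : ℕ) (hg : g.natDegree ≤ n) :
    resultant (rootPoly x) g d n = ∏ i, g.eval (x i) := by
  have h := resultant_eq_prod_eval (rootPoly x) g n hg (rootPoly_splits x)
  rw [rootPoly_natDegree, (rootPoly_monic x).leadingCoeff, one_pow, one_mul] at h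
  rw [h, rootPoly, roots_prod _ _ (rootPoly_monic x).ne_zero]
  simp [List.prod_ofFn]

/-- The resultant depends on the coefficients alone, so it allows recurrences and continuity
arguments that a choice of roots would obstruct. -/
theorem resultant_derivative_eq_rootDisc {f : K[X]} (hm : f.Monic) (hd : f.natDegree = d)
    (hs : f.Splits) :
    resultant f (derivative f) d (d - 1) = (-1) ^ (d * (d - 1) / 2) * rootDisc f := by
  obtain ⟨x, rfl⟩ := exists_eq_rootPoly hm hd hs
  rw [resultant_rootPoly _ _ _ ((natDegree_derivative_le _).trans (by rw [rootPoly_natDegree])),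
    rootDisc_rootPoly, ← prod_prod_compl_sub]
  exact Finset.prod_congr rfl fun i _ => eval_derivative_rootPoly x i

end RootPolynomial

/-! ### Coefficients of G, its differential equation and its recurrence. -/

section GegenbauerCoefficients

variable {K : Type*} [Field K]

/-- The numbers `e_i` for which `gPoly d a (ν + 2d) = ∑ binom(d,i) e_i x^(d-i)`. -/
noncomputable def appellCoeff (a ν : K) (i : ℕ) : K :=
  if Even i then (-1) ^ (i / 2) * a ^ i * ((Nat.doubleFactorial (i - 1) : ℕ) : K) /
    ∏ j ∈ Finset.Icc 1 (i / 2), (ν + 2 * (j : K) + 1) else 0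

theorem appellCoeff_zero (a ν : K) : appellCoeff a ν 0 = 1 := by
  simp [appellCoeff]

theorem appellCoeff_of_odd (a ν : K) {i : ℕ} (hi : ¬ Even i) : appellCoeff a ν i = 0 := by
  simp [appellCoeff, hi]

theorem appellCoeff_add_two (a ν : K) (i : ℕ) (h : Even i → ν + (i : K) + 3 ≠ 0) :
    (ν + (i : K) + 3) * appellCoeff a ν (i + 2) = -((i : K) + 1) * a ^ 2 * appellCoeff a ν i := by
  by_cases hi : Even i
  · have hi2 : Even (i + 2) := by simpa [Nat.even_add] using hi
    obtain ⟨k, rfl⟩ := hi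
    have hk : (k + k + 2) / 2 = k + 1 := by omega
    have hk' : (k + k) / 2 = k := by omega
    have hdf : Nat.doubleFactorial (k + k + 2 - 1) =
        (k + k + 1) * Nat.doubleFactorial (k + k - 1) := by
      -- For `k = 0` truncated subtraction gives `k + k - 1 = 0`, so the case is checked apart.
      rcases k with _ | k
      · rfl
      · have h1 : k + 1 + (k + 1) + 2 - 1 = (k + k + 1) + 2 := by omega
        have h2 : k + 1 + (k + 1) - 1 = k + k + 1 := by omega
        rw [h1, h2, Nat.doubleFactorial_add_two]
        ring
    have h' : ν + 2 * ((k + 1 : ℕ) : K) + 1 ≠ 0 := by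
      have := h ⟨k, rfl⟩
      push_cast at this ⊢
      convert this using 1
      ring
    have heq : ν + ((k + k : ℕ) : K) + 3 = ν + 2 * ((k + 1 : ℕ) : K) + 1 := by
      push_cast
      ring
    rw [appellCoeff, if_pos hi2, appellCoeff, if_pos (Even.add_self k), hk, hk', hdf,
      Finset.prod_Icc_succ_top (by omega), heq, mul_div_assoc', mul_comm (∏ _ ∈ _, _),
      mul_div_mul_left _ _ h', mul_div_assoc']
    push_cast
    ring
  · have hi2 : ¬ Even (i + 2) := by simpa [Nat.even_add] using hi
    rw [appellCoeff_of_odd a ν hi, appellCoeff_of_odd a ν hi2, mul_zero, mul_zero]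

theorem gPoly_eq_sum_range (d : ℕ) (a lam : K) :
    gPoly d a lam = ∑ k ∈ Finset.range (d / 2 + 1),
      C ((-1) ^ k * a ^ (2 * k) * gCoeff d lam k) * X ^ (d - 2 * k) := by
  rw [Finset.range_eq_Ico, Finset.sum_eq_sum_Ico_succ_bot (by omega), gPoly]
  simp [gCoeff, Finset.Ico_add_one_right_eq_Icc]

theorem coeff_gPoly (d : ℕ) (a lam : K) (m : ℕ) :
    (gPoly d a lam).coeff m = (d.choose m : K) * appellCoeff a (lam - 2 * (d : K)) (d - m) := by
  rw [gPoly_eq_sum_range, finsetSum_coeff]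
  simp only [coeff_C_mul, coeff_X_pow, mul_ite, mul_one, mul_zero]
  rcases lt_or_ge d m with hm | hm
  · rw [Nat.choose_eq_zero_of_lt hm, Nat.cast_zero, zero_mul]
    exact Finset.sum_eq_zero fun k _ => if_neg (by omega)
  by_cases he : Even (d - m)
  · obtain ⟨k, hk⟩ := he
    rw [Finset.sum_eq_single k, if_pos (by omega), hk, appellCoeff, if_pos ⟨k, rfl⟩, gCoeff]
    · have h1 : (k + k) / 2 = k := by omega
      have h2 : d.choose (2 * k) = d.choose m := by
        rw [← Nat.choose_symm hm, hk, two_mul]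
      rw [h1, h2, two_mul]
      ring
    · intro j hj hjk
      rw [Finset.mem_range] at hj
      exact if_neg (by omega)
    · intro hk'
      rw [Finset.mem_range] at hk'
      omega
  · rw [appellCoeff_of_odd _ _ he, mul_zero]
    refine Finset.sum_eq_zero fun k hk => if_neg ?_
    rintro rfl
    rw [Finset.mem_range] at hk
    apply he
    have : d - (d - 2 * k) = 2 * k := by omega
    rw [this]
    exact even_two_mul k

theorem natDegree_gPoly (d : ℕ) (a lam : K) : (gPoly d a lam).natDegree = d := by
  apply natDegree_eq_of_le_of_coeff_ne_zero
  · rw [natDegree_le_iff_coeff_eq_zero]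
    intro m hm
    rw [coeff_gPoly, Nat.choose_eq_zero_of_lt hm, Nat.cast_zero, zero_mul]
  · simp [coeff_gPoly, appellCoeff_zero]

theorem gPoly_monic (d : ℕ) (a lam : K) : (gPoly d a lam).Monic := by
  rw [Monic, leadingCoeff, natDegree_gPoly]
  simp [coeff_gPoly, appellCoeff_zero]

/-- Apart from the binomials, the coefficients involve d and λ only through λ-2d, which is unchanged
when d drops by 1 and λ by 2. -/
theorem derivative_gPoly (d : ℕ) (a lam : K) :
    derivative (gPoly (d + 1) a lam) = C ((d : K) + 1) * gPoly d a (lam - 2) := by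
  ext m
  have h : lam - 2 * ((d + 1 : ℕ) : K) = lam - 2 - 2 * (d : K) := by push_cast; ring
  rw [coeff_derivative, coeff_C_mul, coeff_gPoly, coeff_gPoly, h, Nat.add_sub_add_right]
  have := congrArg (Nat.cast : ℕ → K) (Nat.add_one_mul_choose_eq d m)
  push_cast at this
  linear_combination (-appellCoeff a (lam - 2 - 2 * (d : K)) (d - m)) * this

/-- The differential operator `(x² + a²) y'' - λ x y' + d (λ - d + 1) y`. -/
noncomputable def odeOp (d : ℕ) (a lam : K) (f : K[X]) : K[X] :=
  (X ^ 2 + C (a ^ 2)) * derivative (derivative f) - C lam * (X * derivative f) +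
    C ((d : K) * (lam - d + 1)) * f

/-- The operator links only the coefficients m and m+2. The factor (d-m)(λ-d-m+1) vanishes at m = d,
where a solution is normalised; its other zero, m = λ-d+1, is m = d-1 exactly when λ = 2d-2. -/
theorem coeff_odeOp (d : ℕ) (a lam : K) (f : K[X]) (m : ℕ) :
    (odeOp d a lam f).coeff m = ((d : K) - m) * (lam - d - m + 1) * f.coeff m +
      a ^ 2 * ((m : K) + 2) * ((m : K) + 1) * f.coeff (m + 2) := by
  rw [odeOp, add_mul, coeff_add, coeff_sub, coeff_add, coeff_C_mul, coeff_C_mul, coeff_C_mul]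
  have h2 : (derivative (derivative f)).coeff m =
      f.coeff (m + 2) * ((m : K) + 2) * ((m : K) + 1) := by
    rw [coeff_derivative, coeff_derivative]
    push_cast
    ring
  have h1 : (X * derivative f).coeff m = (m : K) * f.coeff m := by
    rcases m with _ | m
    · simp
    · rw [coeff_X_mul, coeff_derivative]
      push_cast
      ring
  have h3 : (X ^ 2 * derivative (derivative f)).coeff m = (m : K) * ((m : K) - 1) * f.coeff m := by
    rcases m with _ | _ | m
    · simp
    · simp [coeff_X_pow_mul']
    · rw [coeff_X_pow_mul, coeff_derivative, coeff_derivative]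
      push_cast
      ring
  rw [h1, h2, h3]
  ring

/-- Descent from the top: once all higher coefficients vanish, the recursion forces the next one to
vanish. -/
theorem eq_zero_of_odeOp_eq_zero {d : ℕ} {a lam : K} {f : K[X]} (hf : odeOp d a lam f = 0)
    (N : ℕ) (hN : ∀ m, N ≤ m → f.coeff m = 0)
    (hne : ∀ m < N, ((d : K) - m) * (lam - d - m + 1) ≠ 0) : f = 0 := by
  induction N with
  | zero => exact ext fun m => by simpa using hN m (Nat.zero_le m)
  | succ N ih =>
    refine ih (fun m hm => ?_) fun m hm => hne m (by omega)
    rcases hm.eq_or_lt with rfl | hm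
    · have h := coeff_odeOp d a lam f N
      rw [hf, coeff_zero, hN (N + 2) (by omega), mul_zero, add_zero] at h
      exact (mul_eq_zero.mp h.symm).resolve_left (hne N (by omega))
    · exact hN m hm

theorem odeOp_sub (d : ℕ) (a lam : K) (f g : K[X]) :
    odeOp d a lam (f - g) = odeOp d a lam f - odeOp d a lam g := by
  simp only [odeOp, derivative_sub]
  ring

theorem odeOp_gPoly {d : ℕ} {a lam : K}
    (h : ∀ j ∈ Finset.Icc 1 (d / 2), lam - 2 * (d : K) + 2 * (j : K) + 1 ≠ 0) :
    odeOp d a lam (gPoly d a lam) = 0 := by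
  ext m
  rw [coeff_odeOp, coeff_gPoly, coeff_gPoly, coeff_zero]
  rcases lt_or_ge d (m + 2) with hm | hm
  · rw [Nat.choose_eq_zero_of_lt hm]
    rcases lt_or_ge d m with hm' | hm'
    · rw [Nat.choose_eq_zero_of_lt hm']
      simp
    · obtain rfl | rfl : d = m ∨ d = m + 1 := by omega
      · simp
      · rw [appellCoeff_of_odd a _ (i := m + 1 - m) (by simp)]
        simp
  · obtain ⟨i, rfl⟩ := Nat.exists_eq_add_of_le hm
    have h1 : m + 2 + i - m = i + 2 := by omega
    have h2 : m + 2 + i - (m + 2) = i := by omega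
    have hrec := appellCoeff_add_two a (lam - 2 * ((m + 2 + i : ℕ) : K)) i (by
      rintro ⟨k, rfl⟩
      have := h (k + 1) (by rw [Finset.mem_Icc]; omega)
      convert this using 1
      push_cast
      ring)
    have hc : ((m + 2 + i).choose (m + 2) : K) * ((m : K) + 2) * ((m : K) + 1) =
        ((m + 2 + i).choose m : K) * ((i : K) + 2) * ((i : K) + 1) := by
      have e1 := Nat.choose_succ_right_eq (m + 2 + i) m
      have e2 := Nat.choose_succ_right_eq (m + 2 + i) (m + 1)
      rw [h1] at e1
      have h3 : m + 2 + i - (m + 1) = i + 1 := by omega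
      rw [h3] at e2
      have e1' := congrArg (Nat.cast : ℕ → K) e1
      have e2' := congrArg (Nat.cast : ℕ → K) e2
      push_cast at e1' e2'
      linear_combination ((m : K) + 1) * e2' + ((i : K) + 1) * e1'
    rw [h1, h2]
    push_cast at hrec hc ⊢
    linear_combination ((m + 2 + i).choose m : K) * ((i : K) + 2) * hrec +
      a ^ 2 * appellCoeff a (lam - 2 * ((m : K) + 2 + i)) i * hc

/-- This is the differential equation of G with both derivatives replaced by lower members of the
Appell family, after cancelling d+2. -/
theorem gPoly_recurrence {d : ℕ} {a lam : K}
    (h : ∀ j ∈ Finset.Icc 1 ((d + 2) / 2), lam - 2 * ((d + 2 : ℕ) : K) + 2 * (j : K) + 1 ≠ 0)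
    (hd : (d : K) + 2 ≠ 0) :
    C (lam - d - 1) * gPoly (d + 2) a lam =
      C (lam) * X * gPoly (d + 1) a (lam - 2) -
        C ((d : K) + 1) * (X ^ 2 + C (a ^ 2)) * gPoly d a (lam - 4) := by
  have h0 := odeOp_gPoly (a := a) h
  have hl : lam - 2 - 2 = lam - 4 := by ring
  rw [odeOp, derivative_gPoly, derivative_C_mul, derivative_gPoly, hl] at h0
  apply mul_left_cancel₀ (C_ne_zero.mpr hd)
  push_cast at h0 ⊢
  have h2 : (C (2 : K)) = 2 := map_ofNat C 2
  simp only [C_add, C_mul, C_sub, C_1, h2] at h0 ⊢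
  linear_combination h0

end GegenbauerCoefficients

/-! ### Resultants of consecutive Appell polynomials. -/

section ResultantRecursion

variable {K : Type*} [Field K]

/-- The Appell sequence `gPoly n a (ν + 2n)`, for fixed `ν`. -/
noncomputable def appellPoly (a ν : K) (n : ℕ) : K[X] := gPoly n a (ν + 2 * (n : K))

theorem appellPoly_zero (a ν : K) : appellPoly a ν 0 = 1 := by
  simp [appellPoly, gPoly]

theorem appellPoly_one (a ν : K) : appellPoly a ν 1 = X := by
  simp [appellPoly, gPoly]

theorem natDegree_appellPoly (a ν : K) (n : ℕ) : (appellPoly a ν n).natDegree = n :=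
  natDegree_gPoly n a _

theorem derivative_appellPoly (a ν : K) (n : ℕ) :
    derivative (appellPoly a ν (n + 1)) = C ((n : K) + 1) * appellPoly a ν n := by
  rw [appellPoly, derivative_gPoly, appellPoly]
  congr 2
  push_cast
  ring

theorem prod_Icc_two_parity {M : Type*} [CommMonoid M] (f : ℕ → M) (d : ℕ) :
    ∏ m ∈ Finset.Icc 2 (d + 1), f m =
      (∏ l ∈ Finset.Icc 1 ((d + 1) / 2), f (2 * l)) *
        ∏ j ∈ Finset.Icc 1 (d / 2), f (2 * j + 1) := by
  induction d with
  | zero => simp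
  | succ d ih =>
    rw [Finset.prod_Icc_succ_top (by omega), ih]
    rcases Nat.even_or_odd' d with ⟨k, rfl | rfl⟩
    · have h1 : (2 * k + 1) / 2 = k := by omega
      have h2 : (2 * k + 1 + 1) / 2 = k + 1 := by omega
      have h3 : 2 * k / 2 = k := by omega
      rw [h1, h2, h3, Finset.prod_Icc_succ_top (by omega)]
      have h4 : 2 * (k + 1) = 2 * k + 1 + 1 := by omega
      rw [h4]
      exact mul_right_comm _ _ _
    · have h1 : (2 * k + 1) / 2 = k := by omega
      have h2 : (2 * k + 1 + 1) / 2 = k + 1 := by omega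
      have h3 : (2 * k + 1 + 1 + 1) / 2 = k + 1 := by omega
      rw [h1, h2, h3, Finset.prod_Icc_succ_top (by omega : 1 ≤ k + 1)
        (fun j => f (2 * j + 1)), mul_assoc]
      rfl

/-- The even m in the denominator cancel the numerator factors with l ≤ ⌈d/2⌉. The surviving
numerator factors and the odd m give the two products on the right, under k = d-l and k = d-j with m
= 2j+1. -/
theorem prod_appell_cancel {ν : K} (h : ∀ n : ℕ, ν + n + 1 ≠ 0) {d : ℕ} (hd : 2 ≤ d) :
    (∏ l ∈ Finset.Icc 1 (d - 1), (ν + 2 * (l : K)) ^ (2 * (d - l))) /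
        ∏ m ∈ Finset.Icc 2 (d + 1), (ν + (m : K)) ^ (2 * d - m) =
      (∏ k ∈ Finset.Icc 1 (d / 2 - 1), (ν + 2 * (d : K) - 2 * (k : K)) ^ (2 * k)) /
        ∏ k ∈ Finset.Icc ((d + 1) / 2) (d - 1),
          (ν + 2 * (d : K) - 2 * (k : K) + 1) ^ (2 * k - 1) := by
  have hodd : ∏ k ∈ Finset.Icc ((d + 1) / 2) (d - 1),
      (ν + 2 * (d : K) - 2 * (k : K) + 1) ^ (2 * k - 1) =
        ∏ j ∈ Finset.Icc 1 (d / 2), (ν + ((2 * j + 1 : ℕ) : K)) ^ (2 * d - (2 * j + 1)) := by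
    refine Finset.prod_nbij' (d - ·) (d - ·) ?_ ?_ ?_ ?_ ?_ <;> intro i hi <;>
      rw [Finset.mem_Icc] at hi
    · rw [Finset.mem_Icc]; omega
    · rw [Finset.mem_Icc]; omega
    · show d - (d - i) = i
      omega
    · show d - (d - i) = i
      omega
    · have e1 : 2 * d - (2 * (d - i) + 1) = 2 * i - 1 := by omega
      rw [e1]
      push_cast [Nat.cast_sub (show i ≤ d by omega)]
      ring
  have heven : ∏ k ∈ Finset.Icc 1 (d / 2 - 1), (ν + 2 * (d : K) - 2 * (k : K)) ^ (2 * k) =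
      ∏ l ∈ Finset.Ico ((d + 1) / 2 + 1) d, (ν + 2 * (l : K)) ^ (2 * (d - l)) := by
    refine Finset.prod_nbij' (d - ·) (d - ·) ?_ ?_ ?_ ?_ ?_ <;> intro i hi <;>
      simp only [Finset.mem_Icc, Finset.mem_Ico] at hi ⊢
    · omega
    · omega
    · omega
    · omega
    · have e1 : d - (d - i) = i := by omega
      rw [e1]
      push_cast [Nat.cast_sub (show i ≤ d by omega)]
      ring
  have hlow : Finset.Icc 1 (d - 1) = Finset.Ico 1 d := by
    ext
    simp only [Finset.mem_Icc, Finset.mem_Ico]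
    omega
  have hlow' : Finset.Icc 1 ((d + 1) / 2) = Finset.Ico 1 ((d + 1) / 2 + 1) := by
    ext
    simp only [Finset.mem_Icc, Finset.mem_Ico]
    omega
  have hE : ∏ l ∈ Finset.Icc 1 ((d + 1) / 2), (ν + ((2 * l : ℕ) : K)) ^ (2 * d - 2 * l) =
      ∏ l ∈ Finset.Ico 1 ((d + 1) / 2 + 1), (ν + 2 * (l : K)) ^ (2 * (d - l)) := by
    rw [hlow']
    refine Finset.prod_congr rfl fun l _ => ?_
    rw [Nat.mul_sub]
    push_cast
    rfl
  have hE0 : ∏ l ∈ Finset.Ico 1 ((d + 1) / 2 + 1), (ν + 2 * (l : K)) ^ (2 * (d - l)) ≠ 0 := by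
    refine Finset.prod_ne_zero_iff.mpr fun l hl => pow_ne_zero _ ?_
    rw [Finset.mem_Ico] at hl
    have := h (2 * l - 1)
    rw [add_assoc, ← Nat.cast_add_one, show 2 * l - 1 + 1 = 2 * l by omega] at this
    push_cast at this
    exact this
  rw [prod_Icc_two_parity, hE, hodd, heven, hlow,
    ← Finset.prod_Ico_consecutive _ (show 1 ≤ (d + 1) / 2 + 1 by omega)
      (show (d + 1) / 2 + 1 ≤ d by omega), mul_div_mul_left _ _ hE0]

variable [CharZero K]

theorem appellPoly_recurrence {a ν : K} (h : ∀ n : ℕ, ν + n + 1 ≠ 0) (n : ℕ) :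
    C (ν + n + 3) * appellPoly a ν (n + 2) =
      C (-((n : K) + 1)) * ((X ^ 2 + C (a ^ 2)) * appellPoly a ν n) +
        appellPoly a ν (n + 1) * (C (ν + 2 * n + 4) * X) := by
  have hr := gPoly_recurrence (d := n) (a := a) (lam := ν + 2 * ((n + 2 : ℕ) : K)) (by
    intro j _
    have := h (2 * j)
    push_cast at this ⊢
    convert this using 1
    ring) (by exact_mod_cast (show n + 2 ≠ 0 by omega))
  have e1 : ν + 2 * ((n + 2 : ℕ) : K) - 2 = ν + 2 * ((n + 1 : ℕ) : K) := by push_cast; ring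
  have e2 : ν + 2 * ((n + 2 : ℕ) : K) - 4 = ν + 2 * (n : K) := by push_cast; ring
  have e3 : ν + 2 * ((n + 2 : ℕ) : K) - n - 1 = ν + n + 3 := by push_cast; ring
  have e4 : ν + 2 * ((n + 2 : ℕ) : K) = ν + 2 * n + 4 := by push_cast; ring
  rw [e1, e2, e3] at hr
  rw [appellPoly, hr, e4, appellPoly, appellPoly, C_neg]
  ring

/-- At z the factor X²+a² vanishes, so the three-term recurrence becomes first order. -/
theorem eval_appellPoly {a ν z : K} (h : ∀ n : ℕ, ν + n + 1 ≠ 0) (hz : z ^ 2 = -a ^ 2) (n : ℕ) :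
    (appellPoly a ν n).eval z =
      z ^ n * ∏ l ∈ Finset.Icc 1 n, ((ν + 2 * (l : K)) / (ν + l + 1)) := by
  induction n with
  | zero => simp [appellPoly_zero]
  | succ n ih =>
    have hn : ν + ((n + 1 : ℕ) : K) + 1 ≠ 0 := h (n + 1)
    have hsplit : z ^ (n + 1) * ((∏ l ∈ Finset.Icc 1 n, ((ν + 2 * (l : K)) / (ν + l + 1))) *
        ((ν + 2 * ((n + 1 : ℕ) : K)) / (ν + ((n + 1 : ℕ) : K) + 1))) =
        (appellPoly a ν n).eval z * z * (ν + 2 * ((n + 1 : ℕ) : K)) /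
          (ν + ((n + 1 : ℕ) : K) + 1) := by
      rw [ih]
      ring
    rw [Finset.prod_Icc_succ_top (by omega), hsplit, eq_div_iff hn]
    rcases n with _ | n
    · rw [zero_add, appellPoly_one, appellPoly_zero, eval_X, eval_one]
      push_cast
      ring
    · have hr := congrArg (eval z) (appellPoly_recurrence (a := a) h n)
      simp only [eval_mul, eval_add, eval_C, eval_pow, eval_X, hz] at hr
      push_cast at hr ⊢
      linear_combination hr

/-- Modulo Q_{n+1} the recurrence leaves only -(n+1)(X²+a²)Q_n. The quadratic factors as (X-z)(X+z),
and each linear factor contributes a value of Q_{n+1}. -/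
theorem resultant_appellPoly_succ {a ν z : K} (h : ∀ n : ℕ, ν + n + 1 ≠ 0) (hz : z ^ 2 = -a ^ 2)
    (n : ℕ) :
    (ν + n + 3) ^ (n + 1) *
        resultant (appellPoly a ν (n + 2)) (appellPoly a ν (n + 1)) (n + 2) (n + 1) =
      (-((n : K) + 1)) ^ (n + 1) *
        ((appellPoly a ν (n + 1)).eval z * (appellPoly a ν (n + 1)).eval (-z)) *
          resultant (appellPoly a ν (n + 1)) (appellPoly a ν n) (n + 1) n := by
  have hdeg : (appellPoly a ν (n + 1)).natDegree ≤ n + 1 := (natDegree_appellPoly a ν _).le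
  have hfac : (X ^ 2 + C (a ^ 2) : K[X]) = (X - C z) * (X - C (-z)) := by
    have : a ^ 2 = -z ^ 2 := by rw [hz, neg_neg]
    rw [this]
    simp only [C_neg, C_pow]
    ring
  rw [← resultant_C_mul_left, appellPoly_recurrence h, resultant_add_mul_left _ _ _ _ _ (by
      have := natDegree_C_mul_le (ν + 2 * (n : K) + 4) X
      rw [natDegree_X] at this
      omega) hdeg, resultant_C_mul_left, hfac, mul_assoc, mul_assoc]
  congr 1
  have e1 := resultant_mul_left (X - C z) ((X - C (-z)) * appellPoly a ν n)
    (appellPoly a ν (n + 1)) (n + 1) hdeg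
  have hm : (appellPoly a ν n).Monic := gPoly_monic _ _ _
  have e2 := resultant_mul_left (X - C (-z)) (appellPoly a ν n)
    (appellPoly a ν (n + 1)) (n + 1) hdeg
  rw [natDegree_X_sub_C, natDegree_appellPoly, resultant_X_sub_C_left _ _ _ hdeg] at e2
  rw [(monic_X_sub_C _).natDegree_mul hm, natDegree_X_sub_C, natDegree_X_sub_C,
    natDegree_appellPoly, resultant_X_sub_C_left _ _ _ hdeg, e2] at e1
  have e3 : 1 + (1 + n) = n + 2 := by omega
  rw [e3] at e1
  rw [e1, resultant_comm (appellPoly a ν n), Even.neg_one_pow (Nat.even_mul_succ_self n), one_mul]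
  ring

/-- The discriminant of `appellPoly`, up to sign, before cancellation. -/
theorem resultant_appellPoly {a ν z : K} (h : ∀ n : ℕ, ν + n + 1 ≠ 0) (hz : z ^ 2 = -a ^ 2)
    (n : ℕ) :
    (-1) ^ ((n + 1) * n / 2) * ((n : K) + 1) ^ (n + 1) *
        resultant (appellPoly a ν (n + 1)) (appellPoly a ν n) (n + 1) n =
      a ^ ((n + 1) * n) * ((∏ k ∈ Finset.Icc 1 (n + 1), (k : K) ^ k) *
        ∏ l ∈ Finset.Icc 1 n, (ν + 2 * (l : K)) ^ (2 * (n + 1 - l))) /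
          ∏ m ∈ Finset.Icc 2 (n + 2), (ν + (m : K)) ^ (2 * (n + 1) - m) := by
  have hne : ∀ m : ℕ, 1 ≤ m → ν + (m : K) ≠ 0 := by
    intro m hm
    obtain ⟨k, rfl⟩ := Nat.exists_eq_add_of_le' hm
    have := h k
    push_cast
    rwa [← add_assoc]
  induction n with
  | zero => simp [appellPoly_zero]
  | succ n ih =>
    have hden : ∀ (N : ℕ) (e : ℕ → ℕ), ∏ m ∈ Finset.Icc 2 N, (ν + (m : K)) ^ e m ≠ 0 := fun N e =>
      Finset.prod_ne_zero_iff.mpr fun m hm => pow_ne_zero _ <| hne m <| by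
        rw [Finset.mem_Icc] at hm; omega
    have hs := resultant_appellPoly_succ (a := a) h hz n
    set r := resultant (appellPoly a ν (n + 1)) (appellPoly a ν n) (n + 1) n
    set r' := resultant (appellPoly a ν (n + 1 + 1)) (appellPoly a ν (n + 1)) (n + 1 + 1) (n + 1)
    have hev : (appellPoly a ν (n + 1)).eval z * (appellPoly a ν (n + 1)).eval (-z) =
        a ^ (2 * (n + 1)) * ((∏ l ∈ Finset.Icc 1 (n + 1), (ν + 2 * (l : K)) ^ 2) /
          ∏ m ∈ Finset.Icc 2 (n + 2), (ν + (m : K)) ^ 2) := by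
      rw [eval_appellPoly h hz, eval_appellPoly h (by rw [neg_sq, hz]), Finset.prod_div_distrib]
      have hsh : ∏ m ∈ Finset.Icc 2 (n + 2), (ν + (m : K)) ^ 2 =
          (∏ l ∈ Finset.Icc 1 (n + 1), (ν + (l : K) + 1)) ^ 2 := by
        rw [← Finset.prod_pow]
        symm
        refine Finset.prod_nbij' (· + 1) (· - 1) ?_ ?_ ?_ ?_ ?_ <;> intro i hi <;>
          rw [Finset.mem_Icc] at hi
        · rw [Finset.mem_Icc]; omega
        · rw [Finset.mem_Icc]; omega
        · simp
        · show i - 1 + 1 = i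
          omega
        · push_cast
          ring
      have hzz : z ^ (n + 1) * (-z) ^ (n + 1) = a ^ (2 * (n + 1)) := by
        rw [← mul_pow, pow_mul]
        congr 1
        linear_combination -hz
      rw [hsh, Finset.prod_pow, ← hzz]
      ring
    have hn3 : ν + (n : K) + 3 ≠ 0 := by
      have := hne (n + 3) (by omega)
      push_cast at this
      rwa [← add_assoc] at this
    have hnum : ∏ l ∈ Finset.Icc 1 (n + 1), (ν + 2 * (l : K)) ^ (2 * (n + 1 + 1 - l)) =
        (∏ l ∈ Finset.Icc 1 n, (ν + 2 * (l : K)) ^ (2 * (n + 1 - l))) *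
          ∏ l ∈ Finset.Icc 1 (n + 1), (ν + 2 * (l : K)) ^ 2 := by
      rw [Finset.prod_Icc_succ_top (by omega), Finset.prod_Icc_succ_top (by omega),
        ← mul_assoc, ← Finset.prod_mul_distrib]
      congr 1
      · refine Finset.prod_congr rfl fun l hl => ?_
        rw [Finset.mem_Icc] at hl
        rw [← pow_add]
        congr 1
        omega
      · congr 1
        omega
    have hdn : ∏ m ∈ Finset.Icc 2 (n + 1 + 2), (ν + (m : K)) ^ (2 * (n + 1 + 1) - m) =
        (∏ m ∈ Finset.Icc 2 (n + 2), (ν + (m : K)) ^ (2 * (n + 1) - m)) *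
          (∏ m ∈ Finset.Icc 2 (n + 2), (ν + (m : K)) ^ 2) * (ν + n + 3) ^ (n + 1) := by
      have : n + 1 + 2 = n + 2 + 1 := rfl
      rw [this, Finset.prod_Icc_succ_top (by omega), ← Finset.prod_mul_distrib]
      congr 1
      · refine Finset.prod_congr rfl fun m hm => ?_
        rw [Finset.mem_Icc] at hm
        rw [← pow_add]
        congr 1
        omega
      · have : 2 * (n + 1 + 1) - (n + 2 + 1) = n + 1 := by omega
        rw [this]
        push_cast
        ring
    have hsign : (-1 : K) ^ ((n + 1 + 1) * (n + 1) / 2) =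
        (-1) ^ ((n + 1) * n / 2) * (-1) ^ (n + 1) := by
      rw [← pow_add]
      congr 1
      have : (n + 1 + 1) * (n + 1) = (n + 1) * n + (n + 1) * 2 := by ring
      rw [this, Nat.add_mul_div_right _ _ two_pos]
    have hpow : a ^ ((n + 1 + 1) * (n + 1)) = a ^ ((n + 1) * n) * a ^ (2 * (n + 1)) := by
      rw [← pow_add]
      congr 1
      ring
    have hneg : (-1 : K) ^ (n + 1) * (-((n : K) + 1)) ^ (n + 1) = ((n : K) + 1) ^ (n + 1) := by
      rw [← mul_pow]
      congr 1
      ring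
    rw [hnum, hdn, hsign, hpow, Finset.prod_Icc_succ_top (by omega : 1 ≤ n + 1 + 1)]
    have hA := hden (n + 2) (fun m => 2 * (n + 1) - m)
    have hB := hden (n + 2) (fun _ => 2)
    rw [eq_div_iff hA] at ih
    set A := ∏ m ∈ Finset.Icc 2 (n + 2), (ν + (m : K)) ^ (2 * (n + 1) - m)
    set B := ∏ m ∈ Finset.Icc 2 (n + 2), (ν + (m : K)) ^ 2
    have hE := pow_ne_zero (n + 1) hn3
    set E := (ν + (n : K) + 3) ^ (n + 1)
    set P := ∏ k ∈ Finset.Icc 1 (n + 1), (k : K) ^ k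
    set L := ∏ l ∈ Finset.Icc 1 n, (ν + 2 * (l : K)) ^ (2 * (n + 1 - l))
    set M := ∏ l ∈ Finset.Icc 1 (n + 1), (ν + 2 * (l : K)) ^ 2
    have hc : ((n + 1 : ℕ) : K) + 1 = ((n + 1 + 1 : ℕ) : K) := by push_cast; ring
    rw [hc]
    set F := ((n + 1 + 1 : ℕ) : K) ^ (n + 1 + 1)
    rw [mul_div_assoc', eq_div_iff hB] at hev
    rw [eq_div_iff (mul_ne_zero (mul_ne_zero hA hB) hE)]
    rw [← hneg] at ih
    linear_combination
      ((-1) ^ ((n + 1) * n / 2) * (-1) ^ (n + 1) * F * A * B) * hs +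
      ((-1) ^ ((n + 1) * n / 2) * (-1) ^ (n + 1) * F * A * (-((n : K) + 1)) ^ (n + 1) * r) * hev +
      (F * a ^ (2 * (n + 1)) * M) * ih

end ResultantRecursion

/-! ### Continuity of the coefficients and the resultant in λ. -/

section Continuity

variable {K : Type*} [Field K] [TopologicalSpace K] [IsTopologicalDivisionRing K]

theorem continuousAt_appellCoeff {a : K} {d : ℕ} {lam₀ : K}
    (h : ∀ j ∈ Finset.Icc 1 (d / 2), lam₀ - 2 * (d : K) + 2 * (j : K) + 1 ≠ 0) {i : ℕ}
    (hi : i ≤ d) :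
    ContinuousAt (fun lam : K => appellCoeff a (lam - 2 * (d : K)) i) lam₀ := by
  by_cases he : Even i
  · simp only [appellCoeff, if_pos he]
    refine ContinuousAt.div (by fun_prop) (by fun_prop) ?_
    refine Finset.prod_ne_zero_iff.mpr fun j hj => h j ?_
    rw [Finset.mem_Icc] at hj ⊢
    omega
  · simp only [appellCoeff, if_neg he]
    exact continuousAt_const

theorem continuousAt_coeff_gPoly {a : K} {d : ℕ} {lam₀ : K}
    (h : ∀ j ∈ Finset.Icc 1 (d / 2), lam₀ - 2 * (d : K) + 2 * (j : K) + 1 ≠ 0) (m : ℕ) :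
    ContinuousAt (fun lam : K => (gPoly d a lam).coeff m) lam₀ := by
  simp only [coeff_gPoly]
  exact continuousAt_const.mul (continuousAt_appellCoeff h (Nat.sub_le d m))

/-- With fixed formal degrees the resultant is the determinant of a matrix whose entries are
coefficients or zero. -/
theorem continuousAt_resultant {T : Type*} [TopologicalSpace T] {F G : T → K[X]} {t₀ : T}
    (hF : ∀ m, ContinuousAt (fun t => (F t).coeff m) t₀)
    (hG : ∀ m, ContinuousAt (fun t => (G t).coeff m) t₀) (m n : ℕ) :
    ContinuousAt (fun t => resultant (F t) (G t) m n) t₀ := by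
  have hs : ContinuousAt (fun t => sylvester (F t) (G t) m n) t₀ := by
    refine continuousAt_pi.mpr fun i => continuousAt_pi.mpr fun j => ?_
    simp only [sylvester, Matrix.of_apply]
    induction j using Fin.addCases with
    | left j =>
      simp only [Fin.addCases_left]
      split_ifs
      · exact hG _
      · exact continuousAt_const
    | right j =>
      simp only [Fin.addCases_right]
      split_ifs
      · exact hF _
      · exact continuousAt_const
  exact (Continuous.matrix_det continuous_id).continuousAt.comp hs

theorem continuousAt_resultant_derivative_gPoly {a : K} {d : ℕ} {lam₀ : K}
    (h : ∀ j ∈ Finset.Icc 1 (d / 2), lam₀ - 2 * (d : K) + 2 * (j : K) + 1 ≠ 0) :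
    ContinuousAt (fun lam : K =>
      resultant (gPoly d a lam) (derivative (gPoly d a lam)) d (d - 1)) lam₀ := by
  refine continuousAt_resultant (continuousAt_coeff_gPoly h) (fun m => ?_) _ _
  simp only [coeff_derivative]
  exact (continuousAt_coeff_gPoly h _).mul continuousAt_const

end Continuity

/-! ### The discriminant formula. -/

theorem rootDisc_eq_resultant {K : Type*} [Field K] {f : K[X]} {d : ℕ} (hm : f.Monic)
    (hd : f.natDegree = d) (hs : f.Splits) :
    rootDisc f = (-1) ^ (d * (d - 1) / 2) * resultant f (derivative f) d (d - 1) := by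
  rw [resultant_derivative_eq_rootDisc hm hd hs, ← mul_assoc, ← mul_pow]
  simp

/-- Since Q_d' = d Q_{d-1}, the discriminant is, up to sign, d^d Res(Q_d, Q_{d-1}). -/
theorem rootDisc_gPoly_of_generic {d : ℕ} (hd : 2 ≤ d) {a lam : ℂ}
    (h : ∀ n : ℕ, lam - 2 * (d : ℂ) + n + 1 ≠ 0) :
    rootDisc (gPoly d a lam) =
        a ^ (d * (d - 1)) *
          (((∏ k ∈ Finset.Icc 1 d, (k : ℂ) ^ k) *
              ∏ k ∈ Finset.Icc 1 (d / 2 - 1), (lam - 2 * (k : ℂ)) ^ (2 * k)) /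
            ∏ k ∈ Finset.Icc ((d + 1) / 2) (d - 1),
              (lam - 2 * (k : ℂ) + 1) ^ (2 * k - 1)) := by
  obtain ⟨n, rfl⟩ := Nat.exists_eq_add_of_le' (show 1 ≤ d by omega)
  have hz : (a * Complex.I) ^ 2 = -a ^ 2 := by
    rw [mul_pow, Complex.I_sq]
    ring
  have hQ : gPoly (n + 1) a lam = appellPoly a (lam - 2 * ((n + 1 : ℕ) : ℂ)) (n + 1) := by
    rw [appellPoly, sub_add_cancel]
  have hr := resultant_appellPoly h hz n
  have hc := prod_appell_cancel h hd
  rw [rootDisc_eq_resultant (gPoly_monic _ _ _) (natDegree_gPoly _ _ _) (IsAlgClosed.splits _),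
    hQ, derivative_appellPoly, resultant_C_mul_right]
  rw [Nat.add_sub_cancel] at hc ⊢
  rw [← mul_assoc, hr, mul_div_assoc, mul_div_assoc, hc, sub_add_cancel, mul_div_assoc]

/-- Both sides are continuous at λ₀ and agree for generic λ. The non-generic values are countable,
so their complement is dense. -/
theorem rootDisc_gPoly {d : ℕ} (hd : 2 ≤ d) {a lam₀ : ℂ}
    (h : ∀ j ∈ Finset.Icc 1 (d / 2), lam₀ - 2 * (d : ℂ) + 2 * (j : ℂ) + 1 ≠ 0) :
    rootDisc (gPoly d a lam₀) =
        a ^ (d * (d - 1)) *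
          (((∏ k ∈ Finset.Icc 1 d, (k : ℂ) ^ k) *
              ∏ k ∈ Finset.Icc 1 (d / 2 - 1), (lam₀ - 2 * (k : ℂ)) ^ (2 * k)) /
            ∏ k ∈ Finset.Icc ((d + 1) / 2) (d - 1),
              (lam₀ - 2 * (k : ℂ) + 1) ^ (2 * k - 1)) := by
  have hL : ContinuousAt (fun lam => rootDisc (gPoly d a lam)) lam₀ := by
    have : (fun lam => rootDisc (gPoly d a lam)) = fun lam => (-1) ^ (d * (d - 1) / 2) *
        resultant (gPoly d a lam) (derivative (gPoly d a lam)) d (d - 1) :=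
      funext fun lam => rootDisc_eq_resultant (gPoly_monic _ _ _) (natDegree_gPoly _ _ _)
        (IsAlgClosed.splits _)
    rw [this]
    exact continuousAt_const.mul (continuousAt_resultant_derivative_gPoly h)
  have hR : ContinuousAt (fun lam : ℂ => a ^ (d * (d - 1)) *
          (((∏ k ∈ Finset.Icc 1 d, (k : ℂ) ^ k) *
              ∏ k ∈ Finset.Icc 1 (d / 2 - 1), (lam - 2 * (k : ℂ)) ^ (2 * k)) /
            ∏ k ∈ Finset.Icc ((d + 1) / 2) (d - 1),
              (lam - 2 * (k : ℂ) + 1) ^ (2 * k - 1))) lam₀ := by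
    refine continuousAt_const.mul (ContinuousAt.div (by fun_prop) (by fun_prop) ?_)
    refine Finset.prod_ne_zero_iff.mpr fun k hk => pow_ne_zero _ ?_
    rw [Finset.mem_Icc] at hk
    have := h (d - k) (by rw [Finset.mem_Icc]; omega)
    rw [Nat.cast_sub (by omega)] at this
    convert this using 1
    ring
  set S : Set ℂ := (Set.range fun n : ℕ => 2 * (d : ℂ) - n - 1)ᶜ
  have hS : Dense S := (Set.countable_range _).dense_compl ℂ
  have : (nhdsWithin lam₀ S).NeBot := mem_closure_iff_nhdsWithin_neBot.mp (hS lam₀)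
  refine tendsto_nhds_unique_of_eventuallyEq (l := nhdsWithin lam₀ S)
    (hL.tendsto.mono_left nhdsWithin_le_nhds)
    (hR.tendsto.mono_left nhdsWithin_le_nhds)
    (eventually_nhdsWithin_of_forall fun lam hlam => ?_)
  refine rootDisc_gPoly_of_generic hd fun n hn => hlam ⟨n, ?_⟩
  linear_combination -hn

/-! ### The weighted discriminant and its maximisers. -/

section Energy

variable {d : ℕ}

/-- The product `∏ (x_k² + a²)`, which is `|f(ai)|²` for `f = ∏ (X - x_k)`. -/
def heightProd (a : ℝ) (x : Fin d → ℝ) : ℝ := ∏ k, (x k ^ 2 + a ^ 2)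

theorem heightProd_pos {a : ℝ} (ha : 0 < a) (x : Fin d → ℝ) : 0 < heightProd a x :=
  Finset.prod_pos fun k _ => by positivity

theorem continuous_heightProd (a : ℝ) : Continuous (heightProd (d := d) a) := by
  unfold heightProd
  fun_prop

theorem norm_aeval_rootPoly_sq (a : ℝ) (x : Fin d → ℝ) :
    ‖aeval ((a : ℂ) * Complex.I) (rootPoly x)‖ ^ 2 = heightProd a x := by
  rw [rootPoly, map_prod, norm_prod, ← Finset.prod_pow, heightProd]
  refine Finset.prod_congr rfl fun k _ => ?_
  rw [map_sub, aeval_X, aeval_C, ← Complex.normSq_eq_norm_sq, Complex.normSq_apply]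
  simp
  ring

theorem pairProd_nonneg (x : Fin d → ℝ) : 0 ≤ pairProd x :=
  Finset.prod_nonneg fun _ _ => Finset.prod_nonneg fun _ _ => sq_nonneg _

theorem continuous_pairProd : Continuous (pairProd : (Fin d → ℝ) → ℝ) := by
  unfold pairProd
  fun_prop

theorem pairProd_ne_zero_iff {K : Type*} [Field K] {x : Fin d → K} :
    pairProd x ≠ 0 ↔ Function.Injective x := by
  rw [pairProd_eq_det, pow_ne_zero_iff two_ne_zero, Matrix.det_vandermonde_ne_zero_iff]

/-- From (x²+a²)(y²+a²) = a²(x-y)² + (xy+a²)²; each index lies in d-1 pairs. -/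
theorem exists_pairProd_le {a : ℝ} (ha : 0 < a) :
    ∃ c : ℝ, 0 < c ∧ ∀ x : Fin d → ℝ, pairProd x ≤ c * heightProd a x ^ (d - 1) := by
  refine ⟨∏ j : Fin d, ∏ _k ∈ Finset.Ioi j, (a ^ 2)⁻¹,
    Finset.prod_pos fun _ _ => Finset.prod_pos fun _ _ => by positivity, fun x => ?_⟩
  have h := Finset.prod_prod_Ioi_mul_eq_prod_prod_off_diag
    (fun _ i : Fin d => x i ^ 2 + a ^ 2)
  have h2 : heightProd a x ^ (d - 1) = ∏ i : Fin d, ∏ _j ∈ {i}ᶜ, (x i ^ 2 + a ^ 2) := by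
    rw [heightProd, ← Finset.prod_pow]
    refine Finset.prod_congr rfl fun i _ => ?_
    rw [Finset.prod_const, Finset.card_compl]
    simp
  rw [h2, ← h, ← Finset.prod_mul_distrib, pairProd]
  refine Finset.prod_le_prod (fun _ _ => Finset.prod_nonneg fun _ _ => sq_nonneg _) fun j _ => ?_
  rw [← Finset.prod_mul_distrib]
  refine Finset.prod_le_prod (fun _ _ => sq_nonneg _) fun k _ => ?_
  rw [inv_mul_eq_div, le_div_iff₀ (by positivity)]
  nlinarith [sq_nonneg (x j * x k + a ^ 2)]

theorem isCompact_heightProd_le {a : ℝ} (ha : 0 < a) (M : ℝ) :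
    IsCompact {x : Fin d → ℝ | heightProd a x ≤ M} := by
  refine Metric.isCompact_of_isClosed_isBounded
    (isClosed_le (continuous_heightProd a) continuous_const) ?_
  rw [isBounded_iff_forall_norm_le]
  -- Each of the other d-1 factors is at least a², which bounds every x_j².
  refine ⟨Real.sqrt (M / (a ^ 2) ^ (d - 1)), fun x hx => ?_⟩
  refine (pi_norm_le_iff_of_nonneg (Real.sqrt_nonneg _)).mpr fun j => ?_
  refine Real.abs_le_sqrt ?_
  rw [le_div_iff₀ (by positivity)]
  have h1 : (a ^ 2) ^ (d - 1) ≤ ∏ k ∈ {j}ᶜ, (x k ^ 2 + a ^ 2) := by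
    have h2 : (a ^ 2) ^ (d - 1) = ∏ _k ∈ ({j}ᶜ : Finset (Fin d)), a ^ 2 := by
      rw [Finset.prod_const, Finset.card_compl]
      simp
    rw [h2]
    exact Finset.prod_le_prod (fun _ _ => sq_nonneg a) fun k _ => by nlinarith [sq_nonneg (x k)]
  have h3 : heightProd a x = (x j ^ 2 + a ^ 2) * ∏ k ∈ {j}ᶜ, (x k ^ 2 + a ^ 2) :=
    Fintype.prod_eq_mul_prod_compl j _
  refine le_trans ?_ (show heightProd a x ≤ M from hx)
  rw [h3]
  exact mul_le_mul (by nlinarith [sq_nonneg a]) h1 (by positivity) (by positivity)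

/-- The weighted discriminant `∏_{j<k} (x_j - x_k)² / ∏ (x_k² + a²)^(λ/2)`. -/
noncomputable def weightedDisc (a lam : ℝ) (x : Fin d → ℝ) : ℝ :=
  pairProd x * heightProd a x ^ (-(lam / 2))

/-- The bound c·H^(d-1-λ/2), with H the height, tends to 0 as H grows. So points of large height
lose to a reference point with distinct coordinates, and the rest form a compact set. -/
theorem exists_weightedDisc_max {a lam : ℝ} (ha : 0 < a) (hd : 1 ≤ d)
    (hlam : 2 * (d : ℝ) - 2 < lam) :
    ∃ x : Fin d → ℝ, pairProd x ≠ 0 ∧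
      ∀ y : Fin d → ℝ, weightedDisc a lam y ≤ weightedDisc a lam x := by
  obtain ⟨c, hc, hle⟩ := exists_pairProd_le (d := d) ha
  set x₀ : Fin d → ℝ := fun i => (i : ℝ)
  have hx₀ : 0 < weightedDisc a lam x₀ := by
    refine mul_pos (lt_of_le_of_ne (pairProd_nonneg _) (Ne.symm ?_))
      (Real.rpow_pos_of_pos (heightProd_pos ha _) _)
    rw [pairProd_ne_zero_iff]
    intro i j hij
    exact Fin.ext (Nat.cast_injective (R := ℝ) hij)
  have hs : 0 < lam / 2 - ((d - 1 : ℕ) : ℝ) := by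
    rw [Nat.cast_sub hd]
    push_cast
    linarith
  have hlim := (tendsto_rpow_neg_atTop hs).const_mul c
  rw [mul_zero] at hlim
  obtain ⟨M, hM⟩ := Filter.eventually_atTop.mp (hlim.eventually (gt_mem_nhds hx₀))
  have hout : ∀ y : Fin d → ℝ, M ≤ heightProd a y →
      weightedDisc a lam y < weightedDisc a lam x₀ := by
    intro y hy
    refine lt_of_le_of_lt ?_ (hM _ hy)
    have hp := heightProd_pos ha y
    rw [neg_sub, sub_eq_add_neg, Real.rpow_add hp, Real.rpow_natCast, ← mul_assoc]
    exact mul_le_mul_of_nonneg_right (hle y) (Real.rpow_nonneg hp.le _)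
  have hmem : heightProd a x₀ ≤ M := by
    by_contra hcon
    exact lt_irrefl _ (hout x₀ (not_le.mp hcon).le)
  have hcont : Continuous (weightedDisc (d := d) a lam) :=
    continuous_pairProd.mul ((continuous_heightProd a).rpow_const
      fun x => Or.inl (heightProd_pos ha x).ne')
  obtain ⟨x, -, hx⟩ := (isCompact_heightProd_le ha M).exists_isMaxOn ⟨x₀, hmem⟩ hcont.continuousOn
  have hxx₀ : weightedDisc a lam x₀ ≤ weightedDisc a lam x := hx hmem
  refine ⟨x, ?_, fun y => ?_⟩
  · intro h0
    rw [weightedDisc, weightedDisc, h0, zero_mul] at hxx₀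
    exact absurd hx₀ (not_lt.mpr hxx₀)
  · rcases le_total (heightProd a y) M with hy | hy
    · exact hx hy
    · exact (hout y hy).le.trans hxx₀

/-- The pairs containing i contribute ∏(s-x_k)² when x_i is replaced by s; all other pairs are
unaffected. Cross-multiplying avoids division when roots coincide. -/
theorem pairProd_update {K : Type*} [Field K] (x : Fin d → K) (i : Fin d) (t : K) :
    pairProd (Function.update x i t) * (∏ k ∈ {i}ᶜ, (x i - x k)) ^ 2 =
      pairProd x * (∏ k ∈ {i}ᶜ, (t - x k)) ^ 2 := by
  have key : ∀ s : K, (-1) ^ (d * (d - 1) / 2) * pairProd (Function.update x i s) =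
      (∏ k ∈ {i}ᶜ, (s - x k)) ^ 2 * ((-1) ^ (d - 1) *
        ∏ j ∈ {i}ᶜ, ∏ k ∈ ({j}ᶜ : Finset (Fin d)).erase i, (x j - x k)) := by
    intro s
    rw [← prod_prod_compl_sub, Fintype.prod_eq_mul_prod_compl i]
    have h1 : ∏ k ∈ {i}ᶜ, (Function.update x i s i - Function.update x i s k) =
        ∏ k ∈ {i}ᶜ, (s - x k) := by
      refine Finset.prod_congr rfl fun k hk => ?_
      rw [Finset.mem_compl, Finset.mem_singleton] at hk
      rw [Function.update_self, Function.update_of_ne hk]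
    have h2 : ∏ j ∈ {i}ᶜ, ∏ k ∈ {j}ᶜ, (Function.update x i s j - Function.update x i s k) =
        ∏ j ∈ {i}ᶜ, (-1 * (s - x j)) * ∏ k ∈ ({j}ᶜ : Finset (Fin d)).erase i, (x j - x k) := by
      refine Finset.prod_congr rfl fun j hj => ?_
      rw [Finset.mem_compl, Finset.mem_singleton] at hj
      have hi : i ∈ ({j}ᶜ : Finset (Fin d)) := by
        rw [Finset.mem_compl, Finset.mem_singleton]
        exact fun h => hj h.symm
      rw [← Finset.mul_prod_erase _ _ hi, Function.update_self, Function.update_of_ne hj]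
      congr 1
      · ring
      · refine Finset.prod_congr rfl fun k hk => ?_
        rw [Function.update_of_ne (Finset.ne_of_mem_erase hk)]
    have h3 : ({i}ᶜ : Finset (Fin d)).card = d - 1 := by
      rw [Finset.card_compl]
      simp
    rw [h1, h2, Finset.prod_mul_distrib, Finset.prod_mul_distrib, Finset.prod_const, h3]
    ring
  have e1 := key t
  have e2 := key (x i)
  rw [Function.update_eq_self] at e2
  have hne : ((-1 : K) ^ (d * (d - 1) / 2)) ≠ 0 := pow_ne_zero _ (by simp)
  apply mul_left_cancel₀ hne
  rw [← mul_assoc, ← mul_assoc, e1, e2]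
  ring

theorem coeff_odeOp_eq_zero {K : Type*} [Field K] {f : K[X]} (hf : f.natDegree ≤ d) (a lam : K)
    {m : ℕ} (hm : d ≤ m) : (odeOp d a lam f).coeff m = 0 := by
  rw [coeff_odeOp, coeff_eq_zero_of_natDegree_lt (show f.natDegree < m + 2 by omega)]
  rcases hm.eq_or_lt with rfl | hm
  · simp
  · rw [coeff_eq_zero_of_natDegree_lt (show f.natDegree < m by omega)]
    simp

theorem odeOp_eq_zero_of_max {a lam : ℝ} (ha : 0 < a) {x : Fin d → ℝ} (hx : pairProd x ≠ 0)
    (hmax : ∀ y : Fin d → ℝ, weightedDisc a lam y ≤ weightedDisc a lam x) :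
    odeOp d a lam (rootPoly x) = 0 := by
  have hinj := pairProd_ne_zero_iff.mp hx
  refine eq_zero_of_degree_lt_of_eval_index_eq_zero Finset.univ hinj.injOn ?_ fun i _ => ?_
  · rw [Finset.card_univ, Fintype.card_fin, degree_lt_iff_coeff_zero]
    exact fun m hm => coeff_odeOp_eq_zero (rootPoly_natDegree x).le a lam hm
  set g : ℝ[X] := ∏ k ∈ {i}ᶜ, (X - C (x k)) with hg
  have hgev : ∀ t, g.eval t = ∏ k ∈ {i}ᶜ, (t - x k) := fun t => by simp [hg, eval_prod]
  have hg0 : g.eval (x i) ≠ 0 := by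
    rw [hgev]
    refine Finset.prod_ne_zero_iff.mpr fun k hk => sub_ne_zero.mpr fun h => ?_
    rw [Finset.mem_compl, Finset.mem_singleton] at hk
    exact hk (hinj h).symm
  have hu : ∀ t : ℝ, 0 < t ^ 2 + a ^ 2 := fun t => by positivity
  -- Up to a positive constant, ψ is the weighted discriminant as a function of the i-th root alone.
  set ψ : ℝ → ℝ := fun t => g.eval t ^ 2 * (t ^ 2 + a ^ 2) ^ (-(lam / 2)) with hψ
  have hψmax : ∀ t, ψ t ≤ ψ (x i) := by
    intro t
    have h1 := hmax (Function.update x i t)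
    have h2 := pairProd_update x i t
    rw [← hgev, ← hgev] at h2
    set V := ∏ k ∈ {i}ᶜ, (x k ^ 2 + a ^ 2) with hV
    have hVpos : 0 < V := Finset.prod_pos fun k _ => hu _
    have h3 : heightProd a x = (x i ^ 2 + a ^ 2) * V := Fintype.prod_eq_mul_prod_compl i _
    have h4 : heightProd a (Function.update x i t) = (t ^ 2 + a ^ 2) * V := by
      rw [heightProd, Fintype.prod_eq_mul_prod_compl i, Function.update_self]
      congr 1
      refine Finset.prod_congr rfl fun k hk => ?_
      rw [Finset.mem_compl, Finset.mem_singleton] at hk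
      rw [Function.update_of_ne hk]
    rw [weightedDisc, weightedDisc, h3, h4, Real.mul_rpow (hu _).le hVpos.le,
      Real.mul_rpow (hu _).le hVpos.le, ← mul_assoc, ← mul_assoc] at h1
    have h5 := le_of_mul_le_mul_right h1 (Real.rpow_pos_of_pos hVpos _)
    have hpos : 0 < pairProd x := lt_of_le_of_ne (pairProd_nonneg x) (Ne.symm hx)
    have h6 := mul_le_mul_of_nonneg_right h5 (sq_nonneg (g.eval (x i)))
    rw [mul_right_comm, h2, mul_right_comm, mul_assoc, mul_assoc] at h6
    refine le_of_mul_le_mul_left ?_ hpos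
    simp only [hψ]
    linear_combination h6
  have hderiv : HasDerivAt ψ (2 * g.eval (x i) * (derivative g).eval (x i) *
      (x i ^ 2 + a ^ 2) ^ (-(lam / 2)) + g.eval (x i) ^ 2 *
        (2 * x i * (-(lam / 2)) * (x i ^ 2 + a ^ 2) ^ (-(lam / 2) - 1))) (x i) := by
    have h1 : HasDerivAt (fun t => g.eval t ^ 2) (2 * g.eval (x i) * (derivative g).eval (x i))
        (x i) := by
      simpa using (g.hasDerivAt (x i)).fun_pow 2
    have h2 : HasDerivAt (fun t : ℝ => t ^ 2 + a ^ 2) (2 * x i) (x i) := by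
      simpa using ((hasDerivAt_id (x i)).fun_pow 2).add_const (a ^ 2)
    exact h1.fun_mul (h2.rpow_const (Or.inl (hu _).ne'))
  have hzero := (IsLocalMax.hasDerivAt_eq_zero (Filter.Eventually.of_forall hψmax) hderiv)
  have hsplit : (x i ^ 2 + a ^ 2) ^ (-(lam / 2)) =
      (x i ^ 2 + a ^ 2) ^ (-(lam / 2) - 1) * (x i ^ 2 + a ^ 2) := by
    rw [← Real.rpow_add_one (hu _).ne', sub_add_cancel]
  rw [hsplit] at hzero
  -- For f = (X - x_i)g one has f'(x_i) = g(x_i) and f''(x_i) = 2g'(x_i), so this is the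
  -- differential equation at x_i.
  have hcrit : 2 * (derivative g).eval (x i) * (x i ^ 2 + a ^ 2) -
      lam * (x i * g.eval (x i)) = 0 := by
    have hne := mul_ne_zero hg0 (Real.rpow_pos_of_pos (hu (x i)) (-(lam / 2) - 1)).ne'
    apply mul_left_cancel₀ hne
    linear_combination hzero
  rw [rootPoly_eq_mul_erase x i, ← hg, odeOp]
  simp only [derivative_mul, derivative_add, derivative_sub, derivative_X, derivative_C, eval_add,
    eval_sub, eval_mul, eval_pow, eval_X, eval_C, sub_self, sub_zero, one_mul, zero_mul, add_zero,
    mul_zero]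
  linear_combination hcrit

theorem eq_gPoly_of_odeOp_eq_zero {K : Type*} [Field K] {a lam : K} {f : K[X]} (hm : f.Monic)
    (hd : f.natDegree = d) (hode : odeOp d a lam f = 0)
    (h : ∀ j ∈ Finset.Icc 1 (d / 2), lam - 2 * (d : K) + 2 * (j : K) + 1 ≠ 0)
    (hne : ∀ m < d, ((d : K) - m) * (lam - d - m + 1) ≠ 0) : f = gPoly d a lam := by
  rw [← sub_eq_zero]
  refine eq_zero_of_odeOp_eq_zero (d := d) (a := a) (lam := lam) ?_ d (fun m hdm => ?_) hne
  · rw [odeOp_sub, hode, odeOp_gPoly h, sub_zero]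
  · rw [coeff_sub]
    rcases hdm.eq_or_lt with rfl | hdm
    · have h1 : f.coeff d = 1 := by rw [← hd]; exact hm
      have h2 : (gPoly d a lam).coeff d = 1 := by
        have := gPoly_monic d a lam
        rwa [Monic, leadingCoeff, natDegree_gPoly] at this
      rw [h1, h2, sub_self]
    · rw [coeff_eq_zero_of_natDegree_lt (by omega),
        coeff_eq_zero_of_natDegree_lt (by rw [natDegree_gPoly]; omega), sub_zero]

theorem gPoly_denom_pos {lam : ℝ} (hlam : 2 * (d : ℝ) - 2 ≤ lam) {j : ℕ} (hj : 1 ≤ j) :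
    0 < lam - 2 * (d : ℝ) + 2 * (j : ℝ) + 1 := by
  have : (1 : ℝ) ≤ j := by exact_mod_cast hj
  linarith

/-- Real-rootedness of G is a by-product: the maximiser is a real root vector, and its polynomial
must be G. -/
theorem exists_gPoly_eq_rootPoly_max {a lam : ℝ} (ha : 0 < a) (hd : 1 ≤ d)
    (hlam : 2 * (d : ℝ) - 2 < lam) :
    ∃ x : Fin d → ℝ, gPoly d a lam = rootPoly x ∧
      ∀ y : Fin d → ℝ, weightedDisc a lam y ≤ weightedDisc a lam x := by
  obtain ⟨x, hx, hmax⟩ := exists_weightedDisc_max ha hd hlam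
  refine ⟨x, (eq_gPoly_of_odeOp_eq_zero (rootPoly_monic x) (rootPoly_natDegree x)
    (odeOp_eq_zero_of_max ha hx hmax) (fun j hj => ?_) fun m hm => ?_).symm, hmax⟩
  · exact (gPoly_denom_pos hlam.le (Finset.mem_Icc.mp hj).1).ne'
  · have : (m : ℝ) + 1 ≤ d := by exact_mod_cast hm
    exact (mul_pos (by linarith) (by linarith)).ne'

end Energy

/-! ### The value of G at ai as a function of λ. -/

section GegenbauerSum

/-- The sum `1 + ∑ binom(d,2k) (2k-1)!! / ∏ (lam - 2d + 2j + 1)`, which is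
`gPoly d a lam` at `ai` divided by `(ai)^d`. -/
noncomputable def gSum {K : Type*} [Field K] (d : ℕ) (lam : K) : K :=
  1 + ∑ k ∈ Finset.Icc 1 (d / 2), gCoeff d lam k

theorem eval_gPoly {K : Type*} [Field K] (d : ℕ) {a z : K} (lam : K) (hz : z ^ 2 = -a ^ 2) :
    (gPoly d a lam).eval z = z ^ d * gSum d lam := by
  rw [gPoly, gSum, mul_add, mul_one, Finset.mul_sum, eval_add, eval_pow, eval_X, eval_finsetSum]
  congr 1
  refine Finset.sum_congr rfl fun k hk => ?_
  rw [Finset.mem_Icc] at hk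
  have h1 : z ^ d = (z ^ 2) ^ k * z ^ (d - 2 * k) := by
    rw [← pow_mul, ← pow_add]
    congr 1
    omega
  rw [h1, hz, eval_mul, eval_C, eval_pow, eval_X, neg_pow (a ^ 2), ← pow_mul]
  ring

theorem gPoly_map {K L : Type*} [Field K] [Field L] (φ : K →+* L) (d : ℕ) (a lam : K) :
    (gPoly d a lam).map φ = gPoly d (φ a) (φ lam) := by
  simp [gPoly, gCoeff, Polynomial.map_sum, map_ofNat φ 2]

theorem gSum_map {K L : Type*} [Field K] [Field L] (φ : K →+* L) (d : ℕ) (lam : K) :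
    φ (gSum d lam) = gSum d (φ lam) := by
  simp [gSum, gCoeff, map_ofNat φ 2]

theorem ofReal_mul_I_sq (a : ℝ) : ((a : ℂ) * Complex.I) ^ 2 = -(a : ℂ) ^ 2 := by
  rw [mul_pow, Complex.I_sq]
  ring

theorem aeval_eq_eval_map (f : ℝ[X]) (z : ℂ) : aeval z f = (f.map Complex.ofRealHom).eval z := by
  rw [eval_map, aeval_def]
  rfl

theorem aeval_gPoly (d : ℕ) (a lam : ℝ) :
    aeval ((a : ℂ) * Complex.I) (gPoly d a lam) =
      ((a : ℂ) * Complex.I) ^ d * ((gSum d lam : ℝ) : ℂ) := by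
  rw [aeval_eq_eval_map, gPoly_map, Complex.ofRealHom_eq_coe, Complex.ofRealHom_eq_coe,
    eval_gPoly d _ (ofReal_mul_I_sq a), ← Complex.ofRealHom_eq_coe lam, ← gSum_map]
  rfl

variable {d : ℕ}

theorem gCoeff_pos {lam : ℝ} (hlam : 2 * (d : ℝ) - 2 ≤ lam) {k : ℕ}
    (hk : k ∈ Finset.Icc 1 (d / 2)) : 0 < gCoeff d lam k := by
  rw [Finset.mem_Icc] at hk
  refine div_pos (mul_pos ?_ ?_) (Finset.prod_pos fun j hj =>
    gPoly_denom_pos hlam (Finset.mem_Icc.mp hj).1)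
  · exact_mod_cast Nat.choose_pos (by omega)
  · exact_mod_cast Nat.doubleFactorial_pos _

theorem gSum_pos {lam : ℝ} (hlam : 2 * (d : ℝ) - 2 ≤ lam) : 0 < gSum d lam :=
  add_pos_of_pos_of_nonneg one_pos (Finset.sum_nonneg fun _ hk => (gCoeff_pos hlam hk).le)

theorem gSum_strictAntiOn (hd : 2 ≤ d) :
    StrictAntiOn (gSum d : ℝ → ℝ) (Set.Ici (2 * (d : ℝ) - 2)) := by
  intro s hs t ht hst
  refine add_lt_add_of_le_of_lt le_rfl (Finset.sum_lt_sum_of_nonempty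
    (Finset.nonempty_Icc.mpr (by omega)) fun k hk => ?_)
  rw [Finset.mem_Icc] at hk
  refine div_lt_div_of_pos_left (mul_pos ?_ ?_) (Finset.prod_pos fun j hj =>
    gPoly_denom_pos hs (Finset.mem_Icc.mp hj).1) (Finset.prod_lt_prod_of_nonempty (fun j hj =>
    gPoly_denom_pos hs (Finset.mem_Icc.mp hj).1) (fun j _ => by linarith)
      (Finset.nonempty_Icc.mpr hk.1))
  · exact_mod_cast Nat.choose_pos (by omega)
  · exact_mod_cast Nat.doubleFactorial_pos _

theorem continuousAt_gSum {lam₀ : ℝ} (h : 2 * (d : ℝ) - 2 ≤ lam₀) :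
    ContinuousAt (gSum d : ℝ → ℝ) lam₀ := by
  unfold gSum
  refine continuousAt_const.add (tendsto_finsetSum _ fun k _ => ?_)
  exact ContinuousAt.div (f := fun _ => _) continuousAt_const (by fun_prop)
    (Finset.prod_ne_zero_iff.mpr fun j hj => (gPoly_denom_pos h (Finset.mem_Icc.mp hj).1).ne')

theorem tendsto_gSum_atTop : Filter.Tendsto (gSum d : ℝ → ℝ) Filter.atTop (nhds 1) := by
  have h : ∀ k ∈ Finset.Icc 1 (d / 2),
      Filter.Tendsto (fun lam : ℝ => gCoeff d lam k) Filter.atTop (nhds 0) := by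
    intro k hk
    have hprod := tendsto_finsetProd (Finset.Icc 1 k) (fun j _ =>
      tendsto_inv_atTop_zero.comp (Filter.tendsto_atTop_add_const_right Filter.atTop
        (-(2 * (d : ℝ)) + 2 * (j : ℝ) + 1) Filter.tendsto_id))
    rw [Finset.prod_const, Nat.card_Icc, zero_pow (by rw [Finset.mem_Icc] at hk; omega)] at hprod
    have := hprod.const_mul ((d.choose (2 * k) : ℝ) * ((Nat.doubleFactorial (2 * k - 1) : ℕ) : ℝ))
    rw [mul_zero] at this
    refine this.congr fun lam => ?_
    rw [gCoeff, div_eq_mul_inv, ← Finset.prod_inv_distrib]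
    congr 1
    refine Finset.prod_congr rfl fun j _ => ?_
    simp only [Function.comp, id]
    congr 1
    ring
  have := (tendsto_finsetSum _ h).const_add (1 : ℝ)
  rw [Finset.sum_const_zero, add_zero] at this
  exact this

end GegenbauerSum

/-! ### The boundary value λ = 2d-2. -/

section ChebyshevCase

theorem odeOp_add {K : Type*} [Field K] (d : ℕ) (a lam : K) (f g : K[X]) :
    odeOp d a lam (f + g) = odeOp d a lam f + odeOp d a lam g := by
  simp only [odeOp, derivative_add]
  ring

theorem odeOp_C_mul {K : Type*} [Field K] (d : ℕ) (a lam c : K) (f : K[X]) :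
    odeOp d a lam (C c * f) = C c * odeOp d a lam f := by
  simp only [odeOp, derivative_C_mul]
  ring

variable {K : Type*} [Field K] {d : ℕ}

theorem odeOp_X_add_C_pow (hd : 2 ≤ d) {a w : K} (hw : w ^ 2 = -a ^ 2) :
    odeOp d a (2 * (d : K) - 2) ((X + C w) ^ d) = 0 := by
  obtain ⟨n, rfl⟩ := Nat.exists_eq_add_of_le' hd
  have hfac : (X ^ 2 + C (a ^ 2) : K[X]) = (X - C w) * (X + C w) := by
    have : a ^ 2 = -w ^ 2 := by rw [hw, neg_neg]
    rw [this]
    simp only [C_neg, C_pow]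
    ring
  have h2 : (C (2 : K)) = 2 := map_ofNat C 2
  rw [odeOp, hfac, derivative_X_add_C_pow, derivative_C_mul, derivative_X_add_C_pow]
  have e1 : n + 2 - 1 = n + 1 := rfl
  rw [e1, Nat.add_sub_cancel]
  push_cast
  simp only [C_add, C_sub, C_mul, C_1, h2]
  ring

variable [CharZero K]

/-- For `λ = 2d - 2` the monic solutions of the differential equation form a line. -/
theorem exists_eq_of_odeOp_eq_zero (hd : 2 ≤ d) {a w : K} (hw : w ^ 2 = -a ^ 2)
    {f : K[X]} (hm : f.Monic) (hdeg : f.natDegree = d)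
    (hode : odeOp d a (2 * (d : K) - 2) f = 0) {α : K}
    (hα : f.coeff (d - 1) = (2 * α - 1) * (d * w)) :
    f = C α * (X + C w) ^ d + C (1 - α) * (X + C (-w)) ^ d := by
  rw [← sub_eq_zero]
  -- The recursion degenerates at m = d-1, so the descent starts below it; α was chosen to match
  -- that free coefficient.
  refine eq_zero_of_odeOp_eq_zero (d := d) (a := a) (lam := 2 * (d : K) - 2) ?_ (d - 1)
    (fun m hdm => ?_) fun m hm' => ?_
  · rw [odeOp_sub, hode, odeOp_add, odeOp_C_mul, odeOp_C_mul, odeOp_X_add_C_pow hd hw,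
      odeOp_X_add_C_pow hd (by rw [neg_sq, hw])]
    simp
  · rw [coeff_sub, coeff_add, coeff_C_mul, coeff_C_mul, coeff_X_add_C_pow, coeff_X_add_C_pow]
    obtain rfl | rfl | hlt : m = d - 1 ∨ m = d ∨ d < m := by omega
    · have e1 : d - (d - 1) = 1 := by omega
      have e2 : d.choose (d - 1) = d := by
        rw [Nat.choose_symm (by omega : 1 ≤ d), Nat.choose_one_right]
      rw [hα, e1, e2]
      ring
    · have : f.coeff m = 1 := by rw [← hdeg]; exact hm
      rw [this]
      simp
    · rw [coeff_eq_zero_of_natDegree_lt (by omega), Nat.choose_eq_zero_of_lt hlt]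
      simp
  · have h1 : ((d : K) - m) ≠ 0 := sub_ne_zero.mpr (by exact_mod_cast (by omega : d ≠ m))
    have h2 : ((d : K) - ((m + 1 : ℕ) : K)) ≠ 0 :=
      sub_ne_zero.mpr (by exact_mod_cast (by omega : d ≠ m + 1))
    refine mul_ne_zero h1 ?_
    convert h2 using 1
    push_cast
    ring

/-- G has no x^(d-1) term, which forces α = 1/2. -/
theorem gPoly_two_mul_sub_two (hd : 2 ≤ d) {a w : K} (hw : w ^ 2 = -a ^ 2) :
    gPoly d a (2 * (d : K) - 2) =
      C (1 / 2) * (X + C w) ^ d + C (1 / 2) * (X + C (-w)) ^ d := by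
  have h := exists_eq_of_odeOp_eq_zero hd hw (gPoly_monic d a (2 * (d : K) - 2))
    (natDegree_gPoly _ _ _) (odeOp_gPoly fun j hj => ?_) (α := 1 / 2) ?_
  · rw [h]
    norm_num
  · rw [Finset.mem_Icc] at hj
    have : 2 * (d : K) - 2 - 2 * d + 2 * j + 1 = ((2 * j - 1 : ℕ) : K) := by
      rw [Nat.cast_sub (by omega)]
      push_cast
      ring
    rw [this]
    exact_mod_cast (by omega : 2 * j - 1 ≠ 0)
  · rw [coeff_gPoly, appellCoeff_of_odd _ _ (by
      have : d - (d - 1) = 1 := by omega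
      rw [this]
      exact Nat.not_even_one)]
    norm_num

/-- The sum does not involve a, so take a = 1 and w = i: there G(w) = (2w)^d/2. -/
theorem gSum_two_mul_sub_two (hd : 2 ≤ d) : gSum d (2 * (d : ℝ) - 2) = 2 ^ (d - 1) := by
  have hw := ofReal_mul_I_sq 1
  have hw0 : ((1 : ℝ) : ℂ) * Complex.I ≠ 0 := by simp
  have h1 := eval_gPoly d (2 * (d : ℂ) - 2) hw
  rw [gPoly_two_mul_sub_two hd hw] at h1
  set w := ((1 : ℝ) : ℂ) * Complex.I
  have h2 : gSum d (2 * (d : ℂ) - 2) = 2 ^ (d - 1) := by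
    apply mul_left_cancel₀ (pow_ne_zero d hw0)
    rw [← h1]
    obtain ⟨n, rfl⟩ := Nat.exists_eq_add_of_le' (show 1 ≤ d by omega)
    simp only [eval_add, eval_mul, eval_C, eval_pow, eval_X, add_neg_cancel, Nat.add_sub_cancel]
    rw [zero_pow (by omega), ← two_mul, mul_pow]
    ring
  have h3 := gSum_map Complex.ofRealHom d (2 * (d : ℝ) - 2)
  simp only [map_sub, map_mul, map_natCast, map_ofNat, h2] at h3
  exact Complex.ofReal_injective (by rw [← Complex.ofRealHom_eq_coe, h3]; push_cast; rfl)

/-- A complex root z satisfies |z+ai| = |z-ai|, hence is real. -/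
theorem gPoly_two_mul_sub_two_splits (hd : 2 ≤ d) {a : ℝ} (ha : 0 < a) :
    (gPoly d a (2 * (d : ℝ) - 2)).Splits := by
  refine Splits.of_splits_map Complex.ofRealHom (IsAlgClosed.splits _) fun z hz => ?_
  have hw := ofReal_mul_I_sq a
  have hroot := (mem_roots'.mp hz).2
  rw [gPoly_map, IsRoot.def] at hroot
  simp only [map_sub, map_mul, map_natCast, map_ofNat, Complex.ofRealHom_eq_coe] at hroot
  rw [gPoly_two_mul_sub_two hd hw] at hroot
  simp only [eval_add, eval_mul, eval_C, eval_pow, eval_X] at hroot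
  have h1 : (z + a * Complex.I) ^ d = -(z + -(a * Complex.I)) ^ d := by
    linear_combination 2 * hroot
  have h2 := congrArg norm h1
  rw [norm_neg, norm_pow, norm_pow] at h2
  have h3 := (pow_left_inj₀ (norm_nonneg _) (norm_nonneg _) (by omega)).mp h2
  have h4 : z.im = 0 := by
    have h5 := congrArg (· ^ 2) h3
    simp only [← Complex.normSq_eq_norm_sq, Complex.normSq_apply] at h5
    simp at h5
    have h6 : a * z.im = 0 := by linear_combination h5 / 4
    exact (mul_eq_zero.mp h6).resolve_left ha.ne'
  exact ⟨z.re, Complex.ext rfl (by simp [h4])⟩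

end ChebyshevCase

/-! ### Extremality and uniqueness of G. -/

section Extremal

variable {d : ℕ}

theorem heightProd_eq_gSum {a lam : ℝ} {x : Fin d → ℝ} (hx : gPoly d a lam = rootPoly x) :
    heightProd a x = (a ^ d * gSum d lam) ^ 2 := by
  rw [← norm_aeval_rootPoly_sq, ← hx, aeval_gPoly]
  rw [norm_mul, norm_pow, norm_mul, Complex.norm_I, mul_one, Complex.norm_real, Complex.norm_real,
    Real.norm_eq_abs, Real.norm_eq_abs, ← abs_pow, ← abs_mul, sq_abs]

/-- The right side no longer mentions the roots, so the maximal value can be followed continuously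
in λ. -/
theorem weightedDisc_eq {a lam : ℝ} {x : Fin d → ℝ} (hx : gPoly d a lam = rootPoly x) :
    weightedDisc a lam x = (-1) ^ (d * (d - 1) / 2) *
      resultant (gPoly d a lam) (derivative (gPoly d a lam)) d (d - 1) *
        ((a ^ d * gSum d lam) ^ 2) ^ (-(lam / 2)) := by
  rw [weightedDisc, heightProd_eq_gSum hx, ← rootDisc_rootPoly, ← hx, rootDisc_eq_resultant
    (gPoly_monic _ _ _) (natDegree_gPoly _ _ _) (by rw [hx]; exact rootPoly_splits x)]

/-- For `λ ≥ 2d - 2`, the polynomial `gPoly d a λ` has real roots, which maximise the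
weighted discriminant. -/
theorem exists_gPoly_eq_rootPoly_max_of_le {a lam : ℝ} (ha : 0 < a) (hd : 2 ≤ d)
    (hlam : 2 * (d : ℝ) - 2 ≤ lam) :
    ∃ x : Fin d → ℝ, gPoly d a lam = rootPoly x ∧
      ∀ y : Fin d → ℝ, weightedDisc a lam y ≤ weightedDisc a lam x := by
  rcases hlam.eq_or_lt with rfl | hlam
  swap
  · exact exists_gPoly_eq_rootPoly_max ha (by omega) hlam
  obtain ⟨x, hx⟩ := exists_eq_rootPoly (gPoly_monic d a _) (natDegree_gPoly d a _)
    (gPoly_two_mul_sub_two_splits hd ha)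
  refine ⟨x, hx, fun y => ?_⟩
  rw [weightedDisc_eq hx]
  have hpos : a ^ d * gSum d (2 * (d : ℝ) - 2) ≠ 0 :=
    (mul_pos (pow_pos ha d) (gSum_pos le_rfl)).ne'
  have hL : ContinuousAt (fun lam : ℝ => weightedDisc a lam y) (2 * (d : ℝ) - 2) := by
    unfold weightedDisc
    exact continuousAt_const.mul (ContinuousAt.rpow (f := fun _ => _) continuousAt_const
      (by fun_prop) (Or.inl (heightProd_pos ha y).ne'))
  have hR : ContinuousAt (fun lam : ℝ => (-1) ^ (d * (d - 1) / 2) *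
      resultant (gPoly d a lam) (derivative (gPoly d a lam)) d (d - 1) *
        ((a ^ d * gSum d lam) ^ 2) ^ (-(lam / 2))) (2 * (d : ℝ) - 2) := by
    refine (continuousAt_const.mul (continuousAt_resultant_derivative_gPoly fun j hj =>
      (gPoly_denom_pos le_rfl (Finset.mem_Icc.mp hj).1).ne')).mul ?_
    exact ContinuousAt.rpow ((continuousAt_const.mul (continuousAt_gSum le_rfl)).pow 2)
      (by fun_prop) (Or.inl (pow_ne_zero 2 hpos))
  -- For fixed y the inequality holds for every λ > 2d-2 and passes to the limit.
  refine le_of_tendsto_of_tendsto (hL.tendsto.mono_left nhdsWithin_le_nhds)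
    (hR.tendsto.mono_left nhdsWithin_le_nhds)
    (eventually_nhdsWithin_of_forall (s := Set.Ioi (2 * (d : ℝ) - 2)) fun lam hlam => ?_)
  obtain ⟨x', hx', hmax⟩ := exists_gPoly_eq_rootPoly_max ha (by omega) hlam
  exact (hmax y).trans (weightedDisc_eq hx').le

theorem exists_rootPoly_of_mem_class {a m : ℝ} {f : ℝ[X]} (hf : f ∈ realRootedClass d a m) :
    ∃ y : Fin d → ℝ, f = rootPoly y ∧ heightProd a y = m ^ 2 := by
  obtain ⟨hm, hd, hs, hn⟩ := hf
  obtain ⟨y, rfl⟩ := exists_eq_rootPoly hm hd hs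
  exact ⟨y, rfl, by rw [← norm_aeval_rootPoly_sq, hn]⟩

theorem gPoly_mem_class {a m lam : ℝ} (ha : 0 < a) (hd : 2 ≤ d) (hlam : 2 * (d : ℝ) - 2 ≤ lam)
    (hsum : gSum d lam = m / a ^ d) : gPoly d a lam ∈ realRootedClass d a m := by
  obtain ⟨x, hx, -⟩ := exists_gPoly_eq_rootPoly_max_of_le ha hd hlam
  refine ⟨gPoly_monic _ _ _, natDegree_gPoly _ _ _, by rw [hx]; exact rootPoly_splits x, ?_⟩
  rw [aeval_gPoly, norm_mul, norm_pow, norm_mul, Complex.norm_I, mul_one, Complex.norm_real,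
    Complex.norm_real, Real.norm_of_nonneg (gSum_pos hlam).le, Real.norm_of_nonneg ha.le, hsum,
    mul_div_cancel₀ _ (pow_pos ha d).ne']

/-- Write f = α(x+w)^d + (1-α)(x-w)^d with w = ai. Reality of f gives 1-α = ᾱ, so Re α = 1/2; the
prescribed norm gives |α| = 1/2. Hence α = 1/2. -/
theorem eq_gPoly_of_norm_aeval {a : ℝ} (ha : 0 < a) (hd : 2 ≤ d) {f : ℝ[X]} (hm : f.Monic)
    (hdeg : f.natDegree = d) (hode : odeOp d a (2 * (d : ℝ) - 2) f = 0)
    (hn : ‖aeval ((a : ℂ) * Complex.I) f‖ = 2 ^ (d - 1) * a ^ d) :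
    f = gPoly d a (2 * (d : ℝ) - 2) := by
  have hw := ofReal_mul_I_sq a
  have hw0 : (a : ℂ) * Complex.I ≠ 0 := by simp [ha.ne']
  set w := (a : ℂ) * Complex.I with hwdef
  have hd0 : (d : ℂ) ≠ 0 := by exact_mod_cast (by omega : d ≠ 0)
  set F := f.map Complex.ofRealHom with hF
  have hodeF : odeOp d (a : ℂ) (2 * (d : ℂ) - 2) F = 0 := by
    have := congrArg (Polynomial.map Complex.ofRealHom) hode
    simpa [odeOp, hF, derivative_map] using this
  obtain ⟨α, hα⟩ : ∃ α : ℂ, F.coeff (d - 1) = (2 * α - 1) * (d * w) :=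
    ⟨(F.coeff (d - 1) / (d * w) + 1) / 2, by field_simp; ring⟩
  have hFeq : F = _ := exists_eq_of_odeOp_eq_zero hd hw (hm.map _)
    (by rw [natDegree_map, hdeg]) hodeF hα
  have hpow : ∀ z : ℂ, (z + z) ^ d = (2 : ℂ) ^ d * z ^ d := fun z => by rw [← two_mul, mul_pow]
  have h1 : F.eval w = α * (2 ^ d * w ^ d) := by
    rw [hFeq]
    simp [hpow, show d ≠ 0 by omega]
  have h2 : F.eval (-w) = (1 - α) * (2 ^ d * (-w) ^ d) := by
    rw [hFeq]
    simp only [eval_add, eval_mul, eval_C, eval_pow, eval_X, neg_add_cancel, hpow]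
    rw [zero_pow (by omega), mul_zero, zero_add]
  have h3 : F.eval (-w) = (starRingEnd ℂ) (F.eval w) := by
    have hcw : (starRingEnd ℂ) w = -w := by simp [hwdef]
    rw [← hcw, hF, ← aeval_eq_eval_map, ← aeval_eq_eval_map]
    exact aeval_conj f w
  have h4 : 1 - α = (starRingEnd ℂ) α := by
    have hne : (2 : ℂ) ^ d * (-w) ^ d ≠ 0 :=
      mul_ne_zero (pow_ne_zero _ two_ne_zero) (pow_ne_zero _ (neg_ne_zero.mpr hw0))
    apply mul_right_cancel₀ hne
    rw [← h2, h3, h1]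
    simp [hwdef, map_ofNat (starRingEnd ℂ) 2]
  have h5 : ‖α‖ = 1 / 2 := by
    rw [aeval_eq_eval_map, ← hF, h1, norm_mul, norm_mul, norm_pow, norm_pow, hwdef, norm_mul,
      Complex.norm_I, mul_one, Complex.norm_real, Real.norm_of_nonneg ha.le] at hn
    obtain ⟨n, rfl⟩ := Nat.exists_eq_add_of_le' (show 1 ≤ d by omega)
    have hne : (2 : ℝ) ^ n * a ^ (n + 1) ≠ 0 := by positivity
    apply mul_right_cancel₀ hne
    rw [Nat.add_sub_cancel] at hn
    simp only [Complex.norm_ofNat] at hn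
    rw [pow_succ (2 : ℝ)] at hn
    linear_combination hn / 2
  have h6 : α = 1 / 2 := by
    have hre := congrArg Complex.re h4
    simp at hre
    have hre' : α.re = 1 / 2 := by linarith
    have hsq := congrArg (· ^ 2) h5
    simp only [← Complex.normSq_eq_norm_sq, Complex.normSq_apply] at hsq
    rw [hre'] at hsq
    have him : α.im = 0 := by
      have : α.im * α.im = 0 := by linarith
      exact mul_self_eq_zero.mp this
    exact Complex.ext (by rw [hre']; norm_num) (by rw [him]; norm_num)
  apply Polynomial.map_injective Complex.ofRealHom Complex.ofReal_injective
  rw [← hF, gPoly_map, hFeq, h6, show (1 : ℂ) - 1 / 2 = 1 / 2 by norm_num]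
  simp only [map_sub, map_mul, map_natCast, map_ofNat, Complex.ofRealHom_eq_coe]
  rw [gPoly_two_mul_sub_two hd hw]

/-- Both root vectors have height m², so the weights cancel. In the equality case y is itself a
global maximiser and satisfies the same differential equation as G. -/
theorem rootDisc_le_rootDisc_gPoly {a m lam : ℝ} (ha : 0 < a) (hm : 0 < m) (hd : 2 ≤ d)
    (hlam : 2 * (d : ℝ) - 2 ≤ lam) (hsum : gSum d lam = m / a ^ d) {f : ℝ[X]}
    (hf : f ∈ realRootedClass d a m) :
    rootDisc f ≤ rootDisc (gPoly d a lam) ∧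
      (rootDisc f = rootDisc (gPoly d a lam) → f = gPoly d a lam) := by
  obtain ⟨x, hx, hmax⟩ := exists_gPoly_eq_rootPoly_max_of_le ha hd hlam
  obtain ⟨y, rfl, hy⟩ := exists_rootPoly_of_mem_class hf
  have hxm : heightProd a x = m ^ 2 := by
    rw [heightProd_eq_gSum hx, hsum, mul_div_cancel₀ _ (pow_pos ha d).ne']
  have hpos : 0 < (m ^ 2) ^ (-(lam / 2)) := Real.rpow_pos_of_pos (by positivity) _
  rw [hx, rootDisc_rootPoly, rootDisc_rootPoly]
  refine ⟨?_, fun heq => ?_⟩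
  · have := hmax y
    rw [weightedDisc, weightedDisc, hy, hxm] at this
    exact le_of_mul_le_mul_right this hpos
  · have hmaxy : ∀ z : Fin d → ℝ, weightedDisc a lam z ≤ weightedDisc a lam y := by
      intro z
      have : weightedDisc a lam y = weightedDisc a lam x := by
        rw [weightedDisc, weightedDisc, hy, hxm, heq]
      rw [this]
      exact hmax z
    have hy0 : pairProd y ≠ 0 := by
      intro h0
      have h1 := hmaxy fun i => (i : ℝ)
      rw [weightedDisc, weightedDisc, h0, zero_mul] at h1
      have h2 : pairProd (fun i : Fin d => (i : ℝ)) ≠ 0 :=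
        pairProd_ne_zero_iff.mpr fun i j hij => Fin.ext (Nat.cast_injective (R := ℝ) hij)
      exact absurd (mul_pos (lt_of_le_of_ne (pairProd_nonneg _) (Ne.symm h2))
        (Real.rpow_pos_of_pos (heightProd_pos ha _) (-(lam / 2)))) (not_lt.mpr h1)
    have hode := odeOp_eq_zero_of_max ha hy0 hmaxy
    rw [← hx]
    rcases hlam.eq_or_lt with rfl | hlam
    · refine eq_gPoly_of_norm_aeval ha hd (rootPoly_monic y) (rootPoly_natDegree y) hode ?_
      rw [hf.2.2.2, ← gSum_two_mul_sub_two hd, hsum, div_mul_cancel₀ _ (pow_pos ha d).ne']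
    · refine eq_gPoly_of_odeOp_eq_zero (rootPoly_monic y) (rootPoly_natDegree y) hode
        (fun j hj => (gPoly_denom_pos hlam.le (Finset.mem_Icc.mp hj).1).ne') fun k hk => ?_
      have : (k : ℝ) + 1 ≤ d := by exact_mod_cast hk
      exact (mul_pos (by linarith) (by linarith)).ne'

theorem exists_gSum_eq (hd : 2 ≤ d) {s : ℝ} (h1 : 1 < s) (h2 : s ≤ 2 ^ (d - 1)) :
    ∃ lam : ℝ, 2 * (d : ℝ) - 2 ≤ lam ∧ gSum d lam = s := by
  obtain ⟨M, hM, hle⟩ := ((tendsto_gSum_atTop (d := d)).eventually (gt_mem_nhds h1)).and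
    (Filter.eventually_ge_atTop (2 * (d : ℝ) - 2)) |>.exists
  have hcont : ContinuousOn (gSum d : ℝ → ℝ) (Set.Icc (2 * (d : ℝ) - 2) M) :=
    fun lam hlam => (continuousAt_gSum hlam.1).continuousWithinAt
  obtain ⟨lam, hlam, hs⟩ := intermediate_value_Icc' hle hcont
    ⟨hM.le, by rw [gSum_two_mul_sub_two hd]; exact h2⟩
  exact ⟨lam, hlam.1, hs⟩

end Extremal

theorem theorem5 (d : ℕ) (hd : 2 ≤ d) :
    (∀ a m : ℝ, 0 < a → a ^ d < m → m ≤ 2 ^ (d - 1) * a ^ d →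
      ∃ lam₀ : ℝ,
        (2 * (d : ℝ) - 2 ≤ lam₀ ∧
          1 + ∑ k ∈ Finset.Icc 1 (d / 2), gCoeff d lam₀ k = m / a ^ d) ∧
        (∀ lam : ℝ, 2 * (d : ℝ) - 2 ≤ lam →
          1 + ∑ k ∈ Finset.Icc 1 (d / 2), gCoeff d lam k = m / a ^ d → lam = lam₀) ∧
        gPoly d a lam₀ ∈ realRootedClass d a m ∧
        (∀ f ∈ realRootedClass d a m, rootDisc f ≤ rootDisc (gPoly d a lam₀)) ∧
        (∀ f ∈ realRootedClass d a m,
          rootDisc f = rootDisc (gPoly d a lam₀) ↔ f = gPoly d a lam₀)) ∧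
    (∀ a lam : ℂ,
      lam ∉ {z : ℂ | ∃ k : ℕ, (d + 1) / 2 ≤ k ∧ k ≤ d - 1 ∧ z = 2 * (k : ℂ) - 1} →
      rootDisc (gPoly d a lam) =
        a ^ (d * (d - 1)) *
          (((∏ k ∈ Finset.Icc 1 d, (k : ℂ) ^ k) *
              ∏ k ∈ Finset.Icc 1 (d / 2 - 1), (lam - 2 * (k : ℂ)) ^ (2 * k)) /
            ∏ k ∈ Finset.Icc ((d + 1) / 2) (d - 1),
              (lam - 2 * (k : ℂ) + 1) ^ (2 * k - 1))) := by
  refine ⟨fun a m ha hm1 hm2 => ?_, fun a lam hlam => ?_⟩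
  · have had : 0 < a ^ d := pow_pos ha d
    obtain ⟨lam₀, hle, hsum⟩ := exists_gSum_eq hd ((one_lt_div had).mpr hm1)
      ((div_le_iff₀ had).mpr hm2)
    have hm : 0 < m := had.trans hm1
    refine ⟨lam₀, ⟨hle, hsum⟩, fun lam hlam hs => ?_, gPoly_mem_class ha hd hle hsum,
      fun f hf => (rootDisc_le_rootDisc_gPoly ha hm hd hle hsum hf).1,
      fun f hf => ⟨(rootDisc_le_rootDisc_gPoly ha hm hd hle hsum hf).2, fun h => by rw [h]⟩⟩
    exact (gSum_strictAntiOn hd).injOn hlam hle (Eq.trans hs hsum.symm)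
  -- A vanishing j-th denominator factor of G means λ = 2(d-j)-1, an excluded value.
  · refine rootDisc_gPoly hd fun j hj h0 => hlam ⟨d - j, ?_, ?_, ?_⟩
    · rw [Finset.mem_Icc] at hj
      omega
    · rw [Finset.mem_Icc] at hj
      omega
    · rw [Finset.mem_Icc] at hj
      rw [Nat.cast_sub (by omega)]
      linear_combination h0
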